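/- Let $\mathbb K=\mathbb R$ or $\mathbb C$; smooth means $C^\infty$ (holomorphic if $\mathbb K=\mathbb C$), and metrics are symmetric $\mathbb K$-bilinear. A Frobenius manifold of dimension $m\ge 1$ is given by a region $\mathcal M\subset\mathbb K^m$ with coordinates $t^1,\dots,t^m$, a smooth prepotential $F:\mathcal M\to\mathbb K$, an affine Euler field $E=(q^i_jt^j+r^i)\partial_{t^i}$ and $d_F\in\mathbb K$ such that, with $c_{ijk}=\partial_i\partial_j\partial_kF$: (i) $\eta_{ij}=c_{1ij}$ is a constant nondegenerate matrix, defining the metric $\langle\partial_i,\partial_j\rangle=\eta_{ij}$; (ii) $\partial_i\circ\partial_j=\eta^{kl}c_{ijl}\,\partial_k$ is a commutative associative multiplication on each tangent space with unity $\mathbb I=\partial_{t^1}$; (iii) $\mathcal L_EF=d_FF+(\text{polynomial of degree}\le 2)$ on $\mathcal M$. Let $\mathcal N\subset\mathcal M$ be a submanifold of dimension $n\ge1$ that is flat: the induced metric $\langle\cdot,\cdot\rangle_{\mathcal N}$ is nondegenerate with zero Riemann curvature. Let $pr$ be the orthogonal projection onto $T_x\mathcal N$. The induced structures on $\mathcal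 N$ are the induced metric, the product $a\star b=pr(a\circ b)$ for $a,b\in T_x\mathcal N$, the unity $\mathbb I_{\mathcal N}=pr(\mathbb I|_{\mathcal N})$ and the Euler field $E_{\mathcal N}=pr(E|_{\mathcal N})$. Call $\mathcal N$ a Frobenius submanifold if around each of its points there are local coordinates $\tau^1,\dots,\tau^n$, ranging over a region of $\mathbb K^n$, in which the induced structures form a Frobenius manifold in the above sense (with some prepotential $F_{\mathcal N}$ and some degree); call it natural if in addition $a\star b=a\circ b$ for all $x\in\mathcal N$ and $a,b\in T_x\mathcal N$. Theorem. Suppose that for every $x\in\mathcal N$ the unity $\mathbb I$, all products $a\circ b$ with $a,b\in T_x\mathcal N$, and the Euler field $E$ at $x$ lie in $T_x\mathcal N$. Then $\mathcal N$ is a natural Frobenius submanifold. Moreover: 1. For every local coordinate system $\tau$ on $\mathcal N$ and every Frobenius manifold structure in these coordinates realising the induced structures, with prepotential $F_{\mathcal N}$, one has $\partial_{\tau^1}=\mathbb I|_{\mathcal N}$, $E_{\mathcal N}=E|_{\mathcal N}$ and $$\frac{\partial^3F_{\mathcal N}}{\partial\tau^\alpha\partial\tau^\beta\partial\tau^\gamma}=\frac{\partial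 t^i}{\partial\tau^\alpha}\frac{\partial t^j}{\partial\tau^\beta}\frac{\partial t^k}{\partial\tau^\gamma}\,c_{ijk}|_{\mathcal N},$$ and the degree of $F_{\mathcal N}$ equals $d_F$, so that $\mathcal L_{E_{\mathcal N}}F_{\mathcal N}=d_FF_{\mathcal N}+(\text{polynomial of degree}\le2)$; and if $\partial_{t^1}E=d_1\,\partial_{t^1}$ for some $d_1\in\mathbb K$, then $\partial_{\tau^1}E_{\mathcal N}=d_1\,\partial_{\tau^1}$ (derivatives of components in the respective flat coordinates). 2. In every local coordinate system $\tau$ on $\mathcal N$ with connected coordinate domain in which the components of the induced metric are constant, $E_{\mathcal N}=(q^\alpha_\beta\tau^\beta+r^\alpha)\partial_{\tau^\alpha}$ with constants $q^\alpha_\beta,r^\alpha$. -/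

import Mathlib

open scoped ContDiff

noncomputable section

section Prelim

variable {𝕜 : Type*} [RCLike 𝕜]

/-- The partial derivative `∂f/∂tⁱ` at `t`. -/
def coordDeriv {m : ℕ} (i : Fin m) (f : (Fin m → 𝕜) → 𝕜) (t : Fin m → 𝕜) : 𝕜 :=
  fderiv 𝕜 f t (Pi.single i 1)

/-- The third partial derivative `∂³f/∂tⁱ∂tʲ∂tᵏ` at `t`. -/
def thirdDeriv {m : ℕ} (f : (Fin m → 𝕜) → 𝕜) (i j k : Fin m) (t : Fin m → 𝕜) : 𝕜 :=
  coordDeriv i (coordDeriv j (coordDeriv k f)) t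

/-- The bilinear form `Σ ηᵢⱼ aⁱ bʲ` with (constant) matrix `η`. -/
def metricForm {m : ℕ} (η : Matrix (Fin m) (Fin m) 𝕜) (a b : Fin m → 𝕜) : 𝕜 :=
  ∑ i, ∑ j, η i j * a i * b j

/-- The multiplication of tangent vectors at `t` with structure functions
`c_{ij}^k = Σ_l η^{kl} ∂³F/∂tⁱ∂tʲ∂tˡ`, i.e. `∂ᵢ ∘ ∂ⱼ = Σ_k c_{ij}^k ∂ₖ`. -/
def prepotentialMul {m : ℕ} (η : Matrix (Fin m) (Fin m) 𝕜) (F : (Fin m → 𝕜) → 𝕜)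
    (t a b : Fin m → 𝕜) : Fin m → 𝕜 :=
  fun k => ∑ i, ∑ j, ∑ l, η⁻¹ k l * thirdDeriv F i j l t * a i * b j

/-- The affine vector field `Σ (qⁱⱼ tʲ + rⁱ) ∂ᵢ`. -/
def affineField {m : ℕ} (q : Matrix (Fin m) (Fin m) 𝕜) (r t : Fin m → 𝕜) : Fin m → 𝕜 :=
  fun i => (∑ j, q i j * t j) + r i

end Prelim

/-- A Frobenius manifold of dimension `m`, given by a prepotential `F` on a region of `𝕜ᵐ`
(`𝕜 = ℝ` or `ℂ`) in flat coordinates `t`. The distinguished coordinate, written `t¹` on paper,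
has index `0 : Fin m`. -/
structure FrobeniusManifold (𝕜 : Type*) [RCLike 𝕜] (m : ℕ) [NeZero m] where
  /-- the region on which the prepotential is defined -/
  region : Set (Fin m → 𝕜)
  isOpen_region : IsOpen region
  isConnected_region : IsConnected region
  /-- the prepotential -/
  F : (Fin m → 𝕜) → 𝕜
  contDiffOn_F : ContDiffOn 𝕜 ∞ F region
  /-- the matrix `ηᵢⱼ` of the metric -/
  η : Matrix (Fin m) (Fin m) 𝕜
  nondegenerate : IsUnit η.det
  normalization : ∀ t ∈ region, ∀ i j, thirdDeriv F 0 i j t = η i j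
  mul_comm' : ∀ t ∈ region, ∀ a b, prepotentialMul η F t a b = prepotentialMul η F t b a
  mul_assoc' : ∀ t ∈ region, ∀ a b c,
    prepotentialMul η F t (prepotentialMul η F t a b) c =
      prepotentialMul η F t a (prepotentialMul η F t b c)
  one_mul' : ∀ t ∈ region, ∀ a, prepotentialMul η F t (Pi.single 0 1) a = a
  /-- linear part of the Euler vector field -/
  q : Matrix (Fin m) (Fin m) 𝕜
  /-- constant part of the Euler vector field -/
  r : Fin m → 𝕜
  /-- the degree of the prepotential -/
  dF : 𝕜
  quasihomogeneous : ∃ (A : Matrix (Fin m) (Fin m) 𝕜) (B : Fin m → 𝕜) (C : 𝕜), ∀ t ∈ region,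
    ∑ i, affineField q r t i * coordDeriv i F t =
      dF * F t + (∑ i, ∑ j, A i j * t i * t j + ∑ i, B i * t i + C)

namespace FrobeniusManifold

variable {𝕜 : Type*} [RCLike 𝕜] {m : ℕ} [NeZero m]

/-- The metric `⟨a, b⟩` of `M`. -/
def metric (M : FrobeniusManifold 𝕜 m) (a b : Fin m → 𝕜) : 𝕜 := metricForm M.η a b

/-- The product `a ∘ b` in the tangent space at `t`. -/
def mul (M : FrobeniusManifold 𝕜 m) (t a b : Fin m → 𝕜) : Fin m → 𝕜 :=
  prepotentialMul M.η M.F t a b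

/-- The unity field `∂/∂t¹`. -/
def unity (_M : FrobeniusManifold 𝕜 m) : Fin m → 𝕜 := Pi.single 0 1

/-- The Euler vector field at `t`. -/
def euler (M : FrobeniusManifold 𝕜 m) (t : Fin m → 𝕜) : Fin m → 𝕜 := affineField M.q M.r t

end FrobeniusManifold

section Submanifolds

variable {𝕜 : Type*} [RCLike 𝕜] {m n : ℕ}

/-- `φ : V → N` is a local parametrization (the inverse of a local coordinate system
`τ¹, …, τⁿ`) of the set `N ⊆ 𝕜ᵐ`: a smooth injective immersion of the open set `V ⊆ 𝕜ⁿ`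
which is an open map into `N` (hence a homeomorphism onto a relatively open part of `N`). -/
structure IsLocalParam (N : Set (Fin m → 𝕜)) (V : Set (Fin n → 𝕜))
    (φ : (Fin n → 𝕜) → (Fin m → 𝕜)) : Prop where
  isOpen : IsOpen V
  contDiffOn : ContDiffOn 𝕜 ∞ φ V
  injective_fderiv : ∀ τ ∈ V, Function.Injective (fderiv 𝕜 φ τ)
  injOn : Set.InjOn φ V
  isOpen_image : ∀ W ⊆ V, IsOpen W → ∃ O : Set (Fin m → 𝕜), IsOpen O ∧ φ '' W = N ∩ O

/-- `N` is an `n`-dimensional (embedded) submanifold of `𝕜ᵐ`. -/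
def IsSubmanifold (n : ℕ) (N : Set (Fin m → 𝕜)) : Prop :=
  ∀ x ∈ N, ∃ (V : Set (Fin n → 𝕜)) (φ : (Fin n → 𝕜) → (Fin m → 𝕜)),
    IsLocalParam N V φ ∧ x ∈ φ '' V

/-- The tangent space `T_x N` of an `n`-dimensional submanifold: it is spanned by the images
of the differentials at `x` of the local parametrizations (these images all agree). -/
def submanifoldTangent (n : ℕ) (N : Set (Fin m → 𝕜)) (x : Fin m → 𝕜) :
    Submodule 𝕜 (Fin m → 𝕜) :=
  Submodule.span 𝕜 {v | ∃ (V : Set (Fin n → 𝕜)) (φ : (Fin n → 𝕜) → (Fin m → 𝕜)) (τ : Fin n → 𝕜),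
    IsLocalParam N V φ ∧ τ ∈ V ∧ φ τ = x ∧ ∃ u, fderiv 𝕜 φ τ u = v}

/-- The Christoffel symbols
`Γ^γ_{αβ} = ½ Σ_δ g^{γδ} (∂_α g_{δβ} + ∂_β g_{δα} - ∂_δ g_{αβ})` of a metric `g` on `𝕜ⁿ`. -/
def christoffel (g : (Fin n → 𝕜) → Matrix (Fin n) (Fin n) 𝕜) (γ α β : Fin n)
    (τ : Fin n → 𝕜) : 𝕜 :=
  (1 / 2) * ∑ δ, (g τ)⁻¹ γ δ *
    (coordDeriv α (fun σ => g σ δ β) τ + coordDeriv β (fun σ => g σ δ α) τ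
      - coordDeriv δ (fun σ => g σ α β) τ)

/-- The Riemann curvature tensor
`R^δ_{γαβ} = ∂_α Γ^δ_{βγ} - ∂_β Γ^δ_{αγ} + Σ_ε (Γ^δ_{αε} Γ^ε_{βγ} - Γ^δ_{βε} Γ^ε_{αγ})`. -/
def riemannCurvature (g : (Fin n → 𝕜) → Matrix (Fin n) (Fin n) 𝕜) (δ γ α β : Fin n)
    (τ : Fin n → 𝕜) : 𝕜 :=
  coordDeriv α (christoffel g δ β γ) τ - coordDeriv β (christoffel g δ α γ) τ
    + ∑ ε, (christoffel g δ α ε τ * christoffel g ε β γ τ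
      - christoffel g δ β ε τ * christoffel g ε α γ τ)

variable [NeZero m] [NeZero n]

/-- The matrix `η_{αβ} = ⟨∂φ/∂τ^α, ∂φ/∂τ^β⟩` of the induced metric in the coordinates `τ`. -/
def inducedMetric (M : FrobeniusManifold 𝕜 m) (φ : (Fin n → 𝕜) → (Fin m → 𝕜))
    (τ : Fin n → 𝕜) : Matrix (Fin n) (Fin n) 𝕜 :=
  fun α β => M.metric (fderiv 𝕜 φ τ (Pi.single α 1)) (fderiv 𝕜 φ τ (Pi.single β 1))

/-- `N` is a flat submanifold of `M`: the induced metric is nondegenerate and has vanishing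
Riemann curvature. -/
structure IsFlatSubmanifold (M : FrobeniusManifold 𝕜 m) (n : ℕ) [NeZero n]
    (N : Set (Fin m → 𝕜)) : Prop where
  isSubmanifold : IsSubmanifold n N
  subset_region : N ⊆ M.region
  nondegenerate : ∀ (V : Set (Fin n → 𝕜)) (φ : (Fin n → 𝕜) → (Fin m → 𝕜)),
    IsLocalParam N V φ → ∀ τ ∈ V, IsUnit (inducedMetric M φ τ).det
  curvature_eq_zero : ∀ (V : Set (Fin n → 𝕜)) (φ : (Fin n → 𝕜) → (Fin m → 𝕜)),
    IsLocalParam N V φ → ∀ τ ∈ V, ∀ δ γ α β,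
      riemannCurvature (inducedMetric M φ) δ γ α β τ = 0

/-- `p = pr v`: `p` is the orthogonal projection (for the metric of `M`) of `v` onto `T`. -/
def IsOrthProj (M : FrobeniusManifold 𝕜 m) (T : Submodule 𝕜 (Fin m → 𝕜))
    (v p : Fin m → 𝕜) : Prop :=
  p ∈ T ∧ ∀ w ∈ T, M.metric (v - p) w = 0

/-- In the coordinates given by the local parametrization `φ` of `N`, the structures induced on
`N` from `M` (metric `⟨a, b⟩`, product `a ⋆ b = pr (a ∘ b)`, unity `pr 𝕀`, Euler field `pr E`)
are those of the Frobenius manifold `K`. -/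
structure IsInducedStructure (M : FrobeniusManifold 𝕜 m) (N : Set (Fin m → 𝕜))
    (K : FrobeniusManifold 𝕜 n) (φ : (Fin n → 𝕜) → (Fin m → 𝕜)) : Prop where
  isLocalParam : IsLocalParam N K.region φ
  metric_eq : ∀ τ ∈ K.region, ∀ a b,
    K.metric a b = M.metric (fderiv 𝕜 φ τ a) (fderiv 𝕜 φ τ b)
  mul_eq : ∀ τ ∈ K.region, ∀ a b,
    IsOrthProj M (submanifoldTangent n N (φ τ))
      (M.mul (φ τ) (fderiv 𝕜 φ τ a) (fderiv 𝕜 φ τ b)) (fderiv 𝕜 φ τ (K.mul τ a b))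
  unity_eq : ∀ τ ∈ K.region,
    IsOrthProj M (submanifoldTangent n N (φ τ)) M.unity (fderiv 𝕜 φ τ K.unity)
  euler_eq : ∀ τ ∈ K.region,
    IsOrthProj M (submanifoldTangent n N (φ τ)) (M.euler (φ τ)) (fderiv 𝕜 φ τ (K.euler τ))

/-- `N` is a Frobenius submanifold of `M`: with the induced structures it is (around each of its
points, in suitable coordinates) a Frobenius manifold. -/
structure IsFrobeniusSubmanifold (M : FrobeniusManifold 𝕜 m) (n : ℕ) [NeZero n]
    (N : Set (Fin m → 𝕜)) : Prop where
  isSubmanifold : IsSubmanifold n N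
  subset_region : N ⊆ M.region
  exists_induced : ∀ x ∈ N, ∃ (K : FrobeniusManifold 𝕜 n) (φ : (Fin n → 𝕜) → (Fin m → 𝕜)),
    IsInducedStructure M N K φ ∧ x ∈ φ '' K.region

/-- `N` is a natural Frobenius submanifold of `M`: moreover `a ⋆ b = a ∘ b` for `a, b ∈ T_x N`,
i.e. `a ∘ b` is its own projection onto `T_x N`. -/
structure IsNaturalFrobeniusSubmanifold (M : FrobeniusManifold 𝕜 m) (n : ℕ) [NeZero n]
    (N : Set (Fin m → 𝕜)) : Prop where
  isFrobeniusSubmanifold : IsFrobeniusSubmanifold M n N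
  natural : ∀ x ∈ N, ∀ a ∈ submanifoldTangent n N x, ∀ b ∈ submanifoldTangent n N x,
    IsOrthProj M (submanifoldTangent n N x) (M.mul x a b) (M.mul x a b)

end Submanifolds

end

/-! Everything rests on working in flat coordinates of the submanifold. If `φ` is the
parametrization in such coordinates, the second derivative `D²φ` is normal to the submanifold
(`hasNormalSecondDeriv_of_const`). Since products of tangent vectors are tangent and `⟨a ∘ b, d⟩ =
c(a, b, d)`, the tensor `c = D³F` vanishes on two tangent vectors and one value of `D²φ`
(`IsTangentImmersion.third_second_fderiv`). Hence all correction terms drop out when the pullback of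
`c` is differentiated: its derivative is the pullback of `D⁴F`, so it is totally symmetric, and
three applications of the Poincaré lemma (`exists_third_potential`) give a prepotential.
Associativity, commutativity and the unity pass to the submanifold because `Dφ` is injective and
multiplicative.

The Euler field needs a separate argument. Quasihomogeneity with the unity in one slot reads `L_E η
= d_F η - c([𝕀, E], ·, ·)`. Both `𝕀` and `E` are tangent, hence so is their bracket, and therefore
`L_E η` vanishes on a tangent vector paired with a value of `D²φ`. So the Lie derivative of the
induced metric along the restricted Euler field has constant components, and the symmetry argument
that makes Killing fields of flat space affine applies
(`IsTangentImmersion.fderiv_fderiv_euler_lift`). Pulling back the quasihomogeneity of `c` then gives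
that of the new prepotential, with the same degree (`exists_isInducedStructure`).

Flat coordinates come from zero curvature: it is the integrability condition of the Pfaffian system
`dP = P Γ` for `P = Dy`. The system is solved by Picard iteration along rays
(`exists_hasFDerivAt_pfaffian`), and symmetry of `Γ` makes `P` a differential
(`exists_flat_coordinates`). The initial value of `P` is chosen so that the unity becomes the first
coordinate field (`IsTangentImmersion.exists_flat_reparam`). For an arbitrary induced structure,
tangency makes every projection trivial, and comparing the two quasihomogeneity relations at the
unity fixes the degree (`IsInducedStructure.properties`). -/

set_option maxSynthPendingDepth 3

/-! ### Integrable Pfaffian systems: Picard iteration along rays. -/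

section PfaffianSystems

open MeasureTheory Metric Set Filter Topology

variable {𝕜 E W : Type*} [RCLike 𝕜] [NormedAddCommGroup E] [NormedSpace ℝ E] [NormedSpace 𝕜 E]
  [NormedAddCommGroup W] [NormedSpace ℝ W] [NormedSpace 𝕜 W]

/-- The line integral of the one-form `θ` along the ray from the origin to `x`. -/
noncomputable def radialIntegral (θ : E → E →L[𝕜] W) (x : E) : W := ∫ s in (0 : ℝ)..1, θ (s • x) x

theorem smul_mem_ball_zero {R s : ℝ} {x : E} (hx : x ∈ ball (0 : E) R) (h0 : 0 ≤ s) (h1 : s ≤ 1) :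
    s • x ∈ ball (0 : E) R := by
  rw [mem_ball_zero_iff] at hx ⊢
  rw [norm_smul, Real.norm_of_nonneg h0]
  exact (mul_le_of_le_one_left (norm_nonneg x) h1).trans_lt hx

theorem continuousOn_comp_smul {G : Type*} [TopologicalSpace G] {R : ℝ} {f : E → G}
    (hf : ContinuousOn f (ball 0 R)) {x : E} (hx : x ∈ ball (0 : E) R) :
    ContinuousOn (fun s : ℝ => f (s • x)) (uIcc 0 1) := by
  rw [uIcc_of_le zero_le_one]
  exact hf.comp (by fun_prop) fun s hs => smul_mem_ball_zero hx hs.1 hs.2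

/-- The derivative of the radial integral of a one-form: the homotopy formula. -/
theorem hasFDerivAt_radialIntegral [ProperSpace E] [CompleteSpace W] {R : ℝ} {θ : E → E →L[𝕜] W}
    {θ' : E → E →L[𝕜] E →L[𝕜] W} (hθ : ∀ x ∈ ball (0 : E) R, HasFDerivAt θ (θ' x) x)
    (hθ' : ContinuousOn θ' (ball 0 R)) {x : E} (hx : x ∈ ball (0 : E) R) :
    HasFDerivAt (radialIntegral θ)
      (θ x + ∫ s in (0 : ℝ)..1, s • ((θ' (s • x)).flip x - θ' (s • x) x)) x := by
  have hθc : ContinuousOn θ (ball 0 R) := fun y hy => (hθ y hy).continuousAt.continuousWithinAt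
  -- The closed ball of radius `r` is compact, so it supplies uniform bounds on `θ` and `θ'` for
  -- differentiation under the integral sign.
  obtain ⟨r, hxr, hrR⟩ := exists_between (mem_ball_zero_iff.1 hx)
  have hsub : closedBall (0 : E) r ⊆ ball 0 R := closedBall_subset_ball hrR
  obtain ⟨C, hC⟩ := (isCompact_closedBall (0 : E) r).exists_bound_of_continuousOn (hθc.mono hsub)
  obtain ⟨C', hC'⟩ := IsCompact.exists_bound_of_continuousOn (E := E →L[𝕜] E →L[𝕜] W)
    (isCompact_closedBall (0 : E) r) (hθ'.mono hsub)
  have hr : 0 ≤ r := (norm_nonneg x).trans hxr.le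
  have hC'0 : 0 ≤ C' := (norm_nonneg _).trans (hC' 0 (by simpa using hr))
  have hcF : ∀ y ∈ ball (0 : E) R, ContinuousOn (fun s : ℝ => θ (s • y) y) (uIcc 0 1) :=
    fun y hy => (continuousOn_comp_smul hθc hy).clm_apply continuousOn_const
  have hflip : ContinuousOn (fun s : ℝ => (θ' (s • x)).flip x) (uIcc 0 1) :=
    ((ContinuousLinearMap.flipₗᵢ 𝕜 E E W).continuous.comp_continuousOn
      (continuousOn_comp_smul hθ' hx)).clm_apply continuousOn_const
  have hcF' : ContinuousOn (fun s : ℝ => θ (s • x) + s • (θ' (s • x)).flip x) (uIcc 0 1) :=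
    (continuousOn_comp_smul hθc hx).add (continuousOn_id.smul hflip)
  have hθ'x : ContinuousOn (fun s : ℝ => θ' (s • x) x) (uIcc 0 1) :=
    (continuousOn_comp_smul hθ' hx).clm_apply continuousOn_const
  have key : HasFDerivAt (radialIntegral θ)
      (∫ s in (0 : ℝ)..1, (θ (s • x) + s • (θ' (s • x)).flip x)) x := by
    refine intervalIntegral.hasFDerivAt_integral_of_dominated_of_fderiv_le
      (F := fun y s => θ (s • y) y) (F' := fun y s => θ (s • y) + s • (θ' (s • y)).flip y)
      (s := ball 0 r) (bound := fun _ => C + C' * r) (isOpen_ball.mem_nhds (by simpa using hxr))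
      ?_ (hcF x hx).intervalIntegrable ?_ ?_ intervalIntegrable_const ?_
    · filter_upwards [isOpen_ball.mem_nhds hx] with y hy
      exact (intervalIntegrable_iff.1 (hcF y hy).intervalIntegrable).aestronglyMeasurable
    · exact (intervalIntegrable_iff.1 hcF'.intervalIntegrable).aestronglyMeasurable
    · refine ae_of_all _ fun s hs y hy => ?_
      rw [uIoc_of_le zero_le_one] at hs
      have hsy := ball_subset_closedBall (smul_mem_ball_zero hy hs.1.le hs.2)
      refine (norm_add_le _ _).trans (add_le_add (hC _ hsy) ?_)
      rw [norm_smul, Real.norm_of_nonneg hs.1.le]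
      refine (mul_le_of_le_one_left (norm_nonneg _) hs.2).trans ?_
      refine ((θ' (s • y)).flip.le_opNorm y).trans ?_
      rw [ContinuousLinearMap.opNorm_flip]
      exact mul_le_mul (hC' _ hsy) (mem_ball_zero_iff.1 hy).le (norm_nonneg _) hC'0
    · refine ae_of_all _ fun s hs y hy => ?_
      rw [uIoc_of_le zero_le_one] at hs
      have hsy := hsub (ball_subset_closedBall (smul_mem_ball_zero hy hs.1.le hs.2))
      have h1 : HasFDerivAt (fun z : E => s • z) (s • ContinuousLinearMap.id 𝕜 E) y :=
        (hasFDerivAt_id (𝕜 := 𝕜) y).const_smul s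
      have h2 := ((hθ _ hsy).comp y h1).clm_apply (hasFDerivAt_id (𝕜 := 𝕜) y)
      refine h2.congr_fderiv ?_
      ext u
      simp
  refine key.congr_fderiv ?_
  -- The integrand is the derivative of `s • θ (s • x)`. Subtracting this identity leaves only the
  -- antisymmetric part of `θ'`, that is, the exterior derivative of `θ`.
  have ftc : ∫ s in (0 : ℝ)..1, (θ (s • x) + s • θ' (s • x) x) = θ x := by
    have := intervalIntegral.integral_eq_sub_of_hasDerivAt (a := (0 : ℝ)) (b := 1)
      (f := fun s : ℝ => s • θ (s • x)) (f' := fun s : ℝ => θ (s • x) + s • θ' (s • x) x) ?_ ?_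
    · simpa using this
    · intro s hs
      rw [uIcc_of_le zero_le_one] at hs
      have h1 : HasDerivAt (fun s : ℝ => s • x) x s := by
        simpa using (hasDerivAt_id s).smul_const x
      have h2 := (((hθ _ (smul_mem_ball_zero hx hs.1 hs.2)).restrictScalars ℝ).comp_hasDerivAt s h1)
      have h3 := (hasDerivAt_id s).smul h2
      refine h3.congr_deriv ?_
      simp [add_comm]
    · exact ((continuousOn_comp_smul hθc hx).add (continuousOn_id.smul hθ'x)).intervalIntegrable
  conv_rhs => rw [← ftc]
  rw [← intervalIntegral.integral_add]
  · refine intervalIntegral.integral_congr fun s _ => ?_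
    simp only [smul_sub]
    abel
  · exact ((continuousOn_comp_smul hθc hx).add (continuousOn_id.smul hθ'x)).intervalIntegrable
  · exact (continuousOn_id.smul (hflip.sub hθ'x)).intervalIntegrable

/-- Gives continuity of the derivative found by the homotopy formula, so that each Picard iterate is
again C¹ and the formula applies to the next one. Replacing `s` by its projection to `[0, 1]` keeps
`s • x` in the ball for every real `s`. -/
theorem continuousOn_integral_comp_smul {G : Type*} [NormedAddCommGroup G] [NormedSpace ℝ G]
    {R : ℝ} {f : E → E → G} (hf : ContinuousOn f.uncurry (ball 0 R ×ˢ univ)) (g : E → G)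
    (hg : ContinuousOn g (ball 0 R)) :
    ContinuousOn (fun x => g x + ∫ s in (0 : ℝ)..1, s • f (s • x) x) (ball 0 R) := by
  refine hg.add ?_
  rw [continuousOn_iff_continuous_domRestrict]
  have : (ball (0 : E) R).domRestrict (fun x => ∫ s in (0 : ℝ)..1, s • f (s • x) x) =
      fun x : ball (0 : E) R => ∫ s in (0 : ℝ)..1,
        s • f ((projIcc (0 : ℝ) 1 zero_le_one s : ℝ) • (x : E)) x := by
    ext x
    refine intervalIntegral.integral_congr fun s hs => ?_
    rw [uIcc_of_le zero_le_one] at hs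
    simp only [projIcc_of_mem zero_le_one hs]
  rw [this]
  refine intervalIntegral.continuous_parametric_intervalIntegral_of_continuous' ?_ _ _
  refine continuous_snd.smul (hf.comp_continuous
    (f := fun p : ball (0 : E) R × ℝ =>
      ((projIcc (0 : ℝ) 1 zero_le_one p.2 : ℝ) • (p.1 : E), (p.1 : E))) ?_ ?_)
  · have := (continuous_projIcc (h := zero_le_one' ℝ))
    fun_prop
  · exact fun p => ⟨smul_mem_ball_zero p.1.2 (projIcc _ _ _ _).2.1 (projIcc _ _ _ _).2.2, mem_univ _⟩

/-- The Picard iteration for the Pfaffian system `dP = B P`, `P 0 = p₀`. -/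
noncomputable def pfaffianStep (B : E → E →L[𝕜] W →L[𝕜] W) (p₀ : W) (P : E → W) (x : E) : W :=
  p₀ + radialIntegral (fun y => (B y).flip (P y)) x

variable {R b : ℝ} {B : E → E →L[𝕜] W →L[𝕜] W} {B' : E → E →L[𝕜] E →L[𝕜] W →L[𝕜] W}

/-- The integrand is linear in `P` with norm at most `b * R`, so smallness of the ball makes the
Picard map a contraction of ratio `1 / 4`. -/
theorem norm_pfaffianStep_sub_le (hBc : ContinuousOn B (ball 0 R))
    (hb : ∀ x ∈ ball (0 : E) R, ‖B x‖ ≤ b) (hbR : b * R ≤ 1 / 4) (p₀ : W) {P P' : E → W}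
    (hP : ContinuousOn P (ball 0 R)) (hP' : ContinuousOn P' (ball 0 R)) {δ : ℝ}
    (hδ : ∀ x ∈ ball (0 : E) R, ‖P x - P' x‖ ≤ δ) {x : E} (hx : x ∈ ball (0 : E) R) :
    ‖pfaffianStep B p₀ P x - pfaffianStep B p₀ P' x‖ ≤ δ / 4 := by
  have hb0 : 0 ≤ b := (norm_nonneg (B x)).trans (hb x hx)
  have hδ0 : 0 ≤ δ := (norm_nonneg _).trans (hδ x hx)
  have hc : ∀ {Q : E → W}, ContinuousOn Q (ball 0 R) →
      IntervalIntegrable (fun s : ℝ => (B (s • x)).flip (Q (s • x)) x) volume 0 1 := fun hQ =>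
    ((((ContinuousLinearMap.flipₗᵢ 𝕜 E W W).continuous.comp_continuousOn
      (continuousOn_comp_smul hBc hx)).clm_apply (continuousOn_comp_smul hQ hx)).clm_apply
        continuousOn_const).intervalIntegrable
  simp only [pfaffianStep, radialIntegral, add_sub_add_left_eq_sub]
  rw [← intervalIntegral.integral_sub (hc hP) (hc hP')]
  refine (intervalIntegral.norm_integral_le_of_norm_le_const (C := δ / 4) fun s hs => ?_).trans
    (by simp)
  rw [uIoc_of_le zero_le_one] at hs
  have hsx := smul_mem_ball_zero hx hs.1.le hs.2
  simp only [ContinuousLinearMap.flip_apply]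
  rw [← map_sub]
  calc ‖B (s • x) x (P (s • x) - P' (s • x))‖ ≤ ‖B (s • x) x‖ * ‖P (s • x) - P' (s • x)‖ :=
        ContinuousLinearMap.le_opNorm _ _
    _ ≤ (b * R) * δ := by
        gcongr
        · exact mul_nonneg hb0 ((norm_nonneg _).trans (mem_ball_zero_iff.1 hx).le)
        · refine ((B (s • x)).le_opNorm x).trans ?_
          gcongr
          · exact hb _ hsx
          · exact (mem_ball_zero_iff.1 hx).le
        · exact hδ _ hsx
    _ ≤ 1 / 4 * δ := by gcongr
    _ = δ / 4 := by ring

set_option maxHeartbeats 1000000 in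
/-- One Picard step preserves continuous differentiability, and (thanks to the integrability
condition) nearly divides the error in the equation `dP = B P` by four. -/
theorem exists_hasFDerivAt_pfaffianStep [ProperSpace E] [CompleteSpace W]
    (hB : ∀ x ∈ ball (0 : E) R, HasFDerivAt B (B' x) x) (hB' : ContinuousOn B' (ball 0 R))
    (hb : ∀ x ∈ ball (0 : E) R, ‖B x‖ ≤ b) (hbR : b * R ≤ 1 / 4)
    (hint : ∀ x ∈ ball (0 : E) R, ∀ u v w,
      B' x v u w + B x u (B x v w) = B' x u v w + B x v (B x u w))
    (p₀ : W) {P : E → W} {Q : E → E →L[𝕜] W} (hP : ∀ x ∈ ball (0 : E) R, HasFDerivAt P (Q x) x)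
    (hQ : ContinuousOn Q (ball 0 R)) :
    ∃ Q₁ : E → E →L[𝕜] W, (∀ x ∈ ball (0 : E) R, HasFDerivAt (pfaffianStep B p₀ P) (Q₁ x) x) ∧
      ContinuousOn Q₁ (ball 0 R) ∧
      ∀ z δ, (∀ x ∈ ball (0 : E) R, ∀ u, ‖Q x u - B x u (P x)‖ ≤ z * ‖u‖) →
        (∀ x ∈ ball (0 : E) R, ‖pfaffianStep B p₀ P x - P x‖ ≤ δ) →
        ∀ x ∈ ball (0 : E) R, ∀ u,
          ‖Q₁ x u - B x u (pfaffianStep B p₀ P x)‖ ≤ (b * δ + z / 2) * ‖u‖ := by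
  have hBc : ContinuousOn B (ball 0 R) := fun y hy => (hB y hy).continuousAt.continuousWithinAt
  have hPc : ContinuousOn P (ball 0 R) := fun y hy => (hP y hy).continuousAt.continuousWithinAt
  -- `F` flips arguments, so that `F (B x) (P x)` is the one-form `v ↦ B x v (P x)` and can be
  -- differentiated by the product rule.
  set F := (ContinuousLinearMap.flipₗᵢ 𝕜 E W W).toContinuousLinearEquiv.toContinuousLinearMap
    with hF
  have hFapp : ∀ A u w, F A w u = A u w := fun A u w => rfl
  set θ : E → E →L[𝕜] W := fun x => F (B x) (P x) with hθdef
  set θ' : E → E →L[𝕜] E →L[𝕜] W := fun x =>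
    (F (B x)).comp (Q x) + (F.comp (B' x)).flip (P x) with hθ'def
  have hθ : ∀ x ∈ ball (0 : E) R, HasFDerivAt θ (θ' x) x := by
    intro x hx
    have h1 :=
      @HasFDerivAt.comp 𝕜 _ E _ _ (E →L[𝕜] W →L[𝕜] W) _ _ (W →L[𝕜] E →L[𝕜] W) _ _ B (B' x) x F F
        F.hasFDerivAt (hB x hx)
    exact h1.clm_apply (hP x hx)
  have hθ'c : ContinuousOn θ' (ball 0 R) := by
    refine ((F.continuous.comp_continuousOn hBc).clm_comp hQ).add (ContinuousOn.clm_apply ?_ hPc)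
    exact (ContinuousLinearMap.flipₗᵢ 𝕜 E W (E →L[𝕜] W)).continuous.comp_continuousOn
      (continuousOn_const.clm_comp hB')
  have hθc : ContinuousOn θ (ball 0 R) := fun y hy => (hθ y hy).continuousAt.continuousWithinAt
  have hθ'app : ∀ x u v, θ' x u v = B x v (Q x u) + B' x u v (P x) := fun x u v => rfl
  have hfc : ContinuousOn (Function.uncurry fun y x => (θ' y).flip x - θ' y x)
      (ball (0 : E) R ×ˢ univ) := by
    have h1 : ContinuousOn (fun p : E × E => θ' p.1) (ball (0 : E) R ×ˢ univ) :=
      hθ'c.comp continuousOn_fst fun p hp => hp.1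
    exact (((ContinuousLinearMap.flipₗᵢ 𝕜 E E W).continuous.comp_continuousOn h1).clm_apply
      continuousOn_snd).sub (h1.clm_apply continuousOn_snd)
  refine ⟨fun x => θ x + ∫ s in (0 : ℝ)..1, s • ((θ' (s • x)).flip x - θ' (s • x) x),
    fun x hx => (hasFDerivAt_radialIntegral hθ hθ'c hx).const_add p₀,
    continuousOn_integral_comp_smul hfc θ hθc, fun z δ hz hδ x hx u => ?_⟩
  have hb0 : 0 ≤ b := (norm_nonneg (B x)).trans (hb x hx)
  have hI : ‖(∫ s in (0 : ℝ)..1, s • ((θ' (s • x)).flip x - θ' (s • x) x)) u‖ ≤ z / 2 * ‖u‖ := by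
    have hii : IntervalIntegrable (fun s : ℝ => s • ((θ' (s • x)).flip x - θ' (s • x) x))
        volume 0 1 := by
      refine (continuousOn_id.smul ((((ContinuousLinearMap.flipₗᵢ 𝕜 E E W).continuous.comp_continuousOn
        (continuousOn_comp_smul hθ'c hx)).clm_apply continuousOn_const).sub
        ((continuousOn_comp_smul hθ'c hx).clm_apply continuousOn_const))).intervalIntegrable
    rw [ContinuousLinearMap.intervalIntegral_apply hii]
    refine (intervalIntegral.norm_integral_le_of_norm_le_const (C := z / 2 * ‖u‖)
      fun s hs => ?_).trans (by simp)
    rw [uIoc_of_le zero_le_one] at hs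
    have hsx := smul_mem_ball_zero hx hs.1.le hs.2
    set y := s • x
    have hz0 : 0 ≤ z * ‖u‖ := (norm_nonneg _).trans (hz x hx u)
    have hxR : ‖x‖ ≤ R := (mem_ball_zero_iff.1 hx).le
    -- The point of integrability: the exterior derivative of `θ` becomes linear in the error `Q - B
    -- P`, since all terms free of the error cancel. The two remaining terms each contribute at most
    -- `z / 4`, which explains the `z / 2`.
    have hid : (s • ((θ' y).flip x - θ' y x)) u =
        s • (B y x (Q y u - B y u (P y)) - B y u (Q y x - B y x (P y))) := by
      have := hint y hsx x u (P y)
      simp only [_root_.smul_apply, _root_.sub_apply,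
        ContinuousLinearMap.flip_apply, hθ'app, map_sub]
      congr 1
      rw [← sub_eq_zero] at this ⊢
      rw [← this]
      abel
    rw [hid, norm_smul, Real.norm_of_nonneg hs.1.le]
    refine (mul_le_of_le_one_left (norm_nonneg _) hs.2).trans ((norm_sub_le _ _).trans ?_)
    have e1 : ‖B y x (Q y u - B y u (P y))‖ ≤ b * ‖x‖ * (z * ‖u‖) := by
      refine (ContinuousLinearMap.le_opNorm _ _).trans ?_
      refine mul_le_mul (((B y).le_opNorm x).trans ?_) (hz y hsx u) (norm_nonneg _) (by positivity)
      gcongr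
      exact hb y hsx
    have e2 : ‖B y u (Q y x - B y x (P y))‖ ≤ b * ‖u‖ * (z * ‖x‖) := by
      refine (ContinuousLinearMap.le_opNorm _ _).trans ?_
      refine mul_le_mul (((B y).le_opNorm u).trans ?_) (hz y hsx x) (norm_nonneg _) (by positivity)
      gcongr
      exact hb y hsx
    have e3 : b * ‖x‖ * (z * ‖u‖) ≤ 1 / 4 * (z * ‖u‖) :=
      mul_le_mul_of_nonneg_right ((mul_le_mul_of_nonneg_left hxR hb0).trans hbR) hz0
    nlinarith
  have h1 : ‖B x u (P x) - B x u (pfaffianStep B p₀ P x)‖ ≤ b * δ * ‖u‖ := by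
    rw [← map_sub]
    refine (ContinuousLinearMap.le_opNorm _ _).trans ?_
    have := (B x).le_opNorm u
    have h2 := hδ x hx
    rw [norm_sub_rev] at h2
    calc _ ≤ (b * ‖u‖) * δ := by
          gcongr
          exact this.trans (by gcongr; exact hb x hx)
      _ = _ := by ring
  have : (θ x + ∫ s in (0 : ℝ)..1, s • ((θ' (s • x)).flip x - θ' (s • x) x)) u -
      B x u (pfaffianStep B p₀ P x) = (B x u (P x) - B x u (pfaffianStep B p₀ P x)) +
        (∫ s in (0 : ℝ)..1, s • ((θ' (s • x)).flip x - θ' (s • x) x)) u := by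
    rw [_root_.add_apply]
    simp only [hθdef, hFapp]
    abel
  rw [this, add_mul]
  exact (norm_add_le _ _).trans (add_le_add h1 hI)

/-- A Pfaffian system `dP = B P` satisfying the integrability condition has a solution with
prescribed value at the centre of a small ball. -/
theorem exists_hasFDerivAt_pfaffian [ProperSpace E] [CompleteSpace W] (hR : 0 < R)
    (hB : ∀ x ∈ ball (0 : E) R, HasFDerivAt B (B' x) x) (hB' : ContinuousOn B' (ball 0 R))
    (hb : ∀ x ∈ ball (0 : E) R, ‖B x‖ ≤ b) (hbR : b * R ≤ 1 / 4)
    (hint : ∀ x ∈ ball (0 : E) R, ∀ u v w,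
      B' x v u w + B x u (B x v w) = B' x u v w + B x v (B x u w)) (p₀ : W) :
    ∃ P : E → W, P 0 = p₀ ∧ ∀ x ∈ ball (0 : E) R, HasFDerivAt P ((B x).flip (P x)) x := by
  have hBc : ContinuousOn B (ball 0 R) := fun y hy => (hB y hy).continuousAt.continuousWithinAt
  have hb0 : 0 ≤ b := (norm_nonneg (B 0)).trans (hb 0 (mem_ball_self hR))
  set P : ℕ → E → W := fun k => (pfaffianStep B p₀)^[k] (fun _ => p₀) with hPdef
  have hPsucc : ∀ k, P (k + 1) = pfaffianStep B p₀ (P k) := fun k =>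
    Function.iterate_succ_apply' _ _ _
  have hdiff : ∀ k, ∃ Q : E → E →L[𝕜] W, (∀ x ∈ ball (0 : E) R, HasFDerivAt (P k) (Q x) x) ∧
      ContinuousOn Q (ball 0 R) := by
    intro k
    induction k with
    | zero => exact ⟨0, fun x _ => hasFDerivAt_const p₀ x, continuousOn_const⟩
    | succ k ih =>
      obtain ⟨Q, h1, h2⟩ := ih
      obtain ⟨Q₁, h3, h4, -⟩ := exists_hasFDerivAt_pfaffianStep hB hB' hb hbR hint p₀ h1 h2
      exact ⟨Q₁, by rwa [hPsucc], h4⟩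
  choose Q hQ hQc using hdiff
  have hPc : ∀ k, ContinuousOn (P k) (ball 0 R) := fun k x hx =>
    (hQ k x hx).continuousAt.continuousWithinAt
  have hdP : ∀ k, ∀ x ∈ ball (0 : E) R, ‖P (k + 1) x - P k x‖ ≤ ‖p₀‖ / 4 / 4 ^ k := by
    intro k
    induction k with
    | zero =>
      intro x hx
      -- The constant start is itself a Picard step, applied to zero; thus the first difference is
      -- also covered by the contraction estimate.
      have h0 : P 0 x = pfaffianStep B p₀ (fun _ => 0) x := by
        simp [hPdef, pfaffianStep, radialIntegral]
      rw [h0, hPsucc]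
      have := norm_pfaffianStep_sub_le hBc hb hbR p₀ (hPc 0) (continuousOn_const (c := (0 : W)))
        (δ := ‖p₀‖) (fun x _ => by simp [hPdef]) hx
      simpa using this
    | succ k ih =>
      intro x hx
      rw [hPsucc (k + 1)]
      nth_rewrite 2 [hPsucc k]
      have := norm_pfaffianStep_sub_le hBc hb hbR p₀ (hPc (k + 1)) (hPc k) ih hx
      rw [pow_succ, ← div_div]
      exact this
  -- The bound solves the recurrence `z (k+1) = z k / 2 + b * ‖p₀‖ / (4 * 4 ^ k)` with `z 0 = b *
  -- ‖p₀‖`.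
  have hz : ∀ k, ∀ x ∈ ball (0 : E) R, ∀ u,
      ‖Q k x u - B x u (P k x)‖ ≤ b * ‖p₀‖ * (2 / 2 ^ k - 1 / 4 ^ k) * ‖u‖ := by
    intro k
    induction k with
    | zero =>
      intro x hx u
      have h0 : Q 0 x = 0 := (hQ 0 x hx).unique (hasFDerivAt_const p₀ x)
      rw [h0]
      simp only [hPdef, Function.iterate_zero, id_eq, _root_.zero_apply, zero_sub,
        norm_neg]
      refine ((B x u).le_opNorm p₀).trans ?_
      have := ((B x).le_opNorm u).trans (mul_le_mul_of_nonneg_right (hb x hx) (norm_nonneg u))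
      calc _ ≤ b * ‖u‖ * ‖p₀‖ := by gcongr
        _ = _ := by norm_num; ring
    | succ k ih =>
      intro x hx u
      obtain ⟨Q₁, h3, -, h5⟩ :=
        exists_hasFDerivAt_pfaffianStep hB hB' hb hbR hint p₀ (hQ k) (hQc k)
      have hQ₁ : Q (k + 1) x = Q₁ x := (hQ (k + 1) x hx).unique (by rw [hPsucc]; exact h3 x hx)
      have := h5 _ (‖p₀‖ / 4 / 4 ^ k) ih (fun y hy => by rw [← hPsucc]; exact hdP k y hy) x hx u
      rw [hQ₁, hPsucc]
      refine this.trans (le_of_eq ?_)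
      congr 1
      rw [pow_succ, pow_succ]
      field_simp
      ring
  have hdP2 : ∀ k, ∀ x ∈ ball (0 : E) R, ‖P (k + 1) x - P k x‖ ≤ ‖p₀‖ / 2 / 2 ^ k := by
    intro k x hx
    refine (hdP k x hx).trans ?_
    gcongr <;> norm_num
  have hlim : ∀ x, ∃ p, x ∈ ball (0 : E) R → Tendsto (fun k => P k x) atTop (𝓝 p) := by
    intro x
    by_cases hx : x ∈ ball (0 : E) R
    · obtain ⟨p, hp⟩ := cauchySeq_tendsto_of_complete
        (cauchySeq_of_le_geometric_two (C := ‖p₀‖) (f := fun k => P k x) fun k => by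
          rw [dist_comm, dist_eq_norm]; exact hdP2 k x hx)
      exact ⟨p, fun _ => hp⟩
    · exact ⟨0, fun h => (hx h).elim⟩
  choose p hp using hlim
  have hpb : ∀ k, ∀ x ∈ ball (0 : E) R, ‖P k x - p x‖ ≤ ‖p₀‖ / 2 ^ k := fun k x hx => by
    rw [← dist_eq_norm]
    exact dist_le_of_le_geometric_two_of_tendsto (C := ‖p₀‖) (f := fun k => P k x)
      (fun k => by rw [dist_comm, dist_eq_norm]; exact hdP2 k x hx) (hp x hx) k
  refine ⟨p, ?_, fun x hx => ?_⟩
  · refine tendsto_nhds_unique (hp 0 (mem_ball_self hR)) ?_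
    have : ∀ k, P k 0 = p₀ := by
      rintro (_ | k)
      · rfl
      · rw [hPsucc]; simp [pfaffianStep, radialIntegral]
    simp [this]
  -- The iterates only solve the equation up to the error `z k`, which tends to zero; so their
  -- derivatives converge uniformly to `B P` at the limit, and the limit is an exact solution.
  · refine hasFDerivAt_of_tendstoUniformlyOn (f := P) (f' := Q) (l := atTop)
      (g' := fun x => (B x).flip (p x)) isOpen_ball ?_ hQ hp hx
    rw [Metric.tendstoUniformlyOn_iff]
    intro ε hε
    -- Of the factor `3`, two parts come from the equation error `hz` and one from the distance
    -- `hpb` to the limit.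
    have hlim0 : Tendsto (fun k : ℕ => (3 * b * ‖p₀‖) * (1 / 2 : ℝ) ^ k) atTop (𝓝 0) := by
      simpa using (tendsto_pow_atTop_nhds_zero_of_lt_one (r := (1 / 2 : ℝ)) (by norm_num)
        (by norm_num)).const_mul (3 * b * ‖p₀‖)
    filter_upwards [hlim0.eventually (gt_mem_nhds hε)] with k hk y hy
    rw [dist_comm, dist_eq_norm]
    refine lt_of_le_of_lt (ContinuousLinearMap.opNorm_le_bound _ (by positivity) fun u => ?_) hk
    have e1 : (Q k y - (B y).flip (p y)) u =
        (Q k y u - B y u (P k y)) + B y u (P k y - p y) := by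
      simp [map_sub]
    have e2 : ‖B y u (P k y - p y)‖ ≤ b * ‖u‖ * (‖p₀‖ / 2 ^ k) :=
      ((B y u).le_opNorm _).trans (mul_le_mul (((B y).le_opNorm u).trans
        (mul_le_mul_of_nonneg_right (hb y hy) (norm_nonneg u))) (hpb k y hy) (norm_nonneg _)
        (by positivity))
    rw [e1]
    refine (norm_add_le _ _).trans ((add_le_add (hz k y hy u) e2).trans ?_)
    have e3 : b * ‖p₀‖ * (2 / 2 ^ k - 1 / 4 ^ k) * ‖u‖ ≤ b * ‖p₀‖ * (2 / 2 ^ k) * ‖u‖ := by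
      gcongr
      exact sub_le_self _ (by positivity)
    refine (add_le_add_left e3 _).trans (le_of_eq ?_)
    rw [one_div, inv_pow]
    ring

end PfaffianSystems

/-! ### Regularity of solutions. -/

section SmoothSolutions

variable {𝕜 E W : Type*} [RCLike 𝕜] [NormedAddCommGroup E] [NormedSpace 𝕜 E]
  [NormedAddCommGroup W] [NormedSpace 𝕜 W]

theorem contDiffOn_infty_of_hasFDerivAt {U : Set E} (hUo : IsOpen U) {f : E → W}
    {f' : E → E →L[𝕜] W} (hf : ∀ x ∈ U, HasFDerivAt f (f' x) x) (hf' : ContDiffOn 𝕜 ∞ f' U) :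
    ContDiffOn 𝕜 ∞ f U := by
  rw [contDiffOn_infty_iff_fderiv_of_isOpen hUo]
  exact ⟨fun x hx => (hf x hx).differentiableAt.differentiableWithinAt,
    hf'.congr fun x hx => (hf x hx).fderiv⟩

/-- Solutions of smooth Pfaffian systems are smooth. -/
theorem contDiffOn_infty_of_pfaffian {U : Set E} (hUo : IsOpen U)
    {B : E → E →L[𝕜] W →L[𝕜] W} (hB : ContDiffOn 𝕜 ∞ B U) {P : E → W}
    (hP : ∀ x ∈ U, HasFDerivAt P ((B x).flip (P x)) x) : ContDiffOn 𝕜 ∞ P U := by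
  have hBf : ContDiffOn 𝕜 ∞ (fun x => (B x).flip) U :=
    (ContinuousLinearMap.flipₗᵢ 𝕜 E W W).contDiff.comp_contDiffOn hB
  rw [contDiffOn_infty]
  intro k
  induction k with
  | zero =>
    exact contDiffOn_zero.2 fun x hx => (hP x hx).continuousAt.continuousWithinAt
  | succ k ih =>
    push_cast
    rw [contDiffOn_succ_iff_fderiv_of_isOpen hUo]
    refine ⟨fun x hx => (hP x hx).differentiableAt.differentiableWithinAt, by simp, ?_⟩
    -- Bootstrap: the equation writes the derivative of `P` in terms of `B` and `P`, so it is as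
    -- regular as `P`.
    refine ContDiffOn.congr ?_ fun x hx => (hP x hx).fderiv
    exact (hBf.of_le (by exact_mod_cast le_top)).clm_apply ih

end SmoothSolutions

/-! ### The Poincaré lemma and flat coordinates of a connection. -/

section FlatCoordinates

open Metric Set

variable {𝕜 E W : Type*} [RCLike 𝕜] [NormedAddCommGroup E] [NormedSpace ℝ E] [NormedSpace 𝕜 E]
  [NormedAddCommGroup W] [NormedSpace ℝ W] [NormedSpace 𝕜 W]

/-- The Poincaré lemma for one-forms on an open convex set. -/
theorem exists_primitive_of_symmetric [CompleteSpace W] {U : Set E} (hU : Convex ℝ U)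
    (hUo : IsOpen U) {θ : E → E →L[𝕜] W} {θ' : E → E →L[𝕜] E →L[𝕜] W}
    (hθ : ∀ x ∈ U, HasFDerivAt θ (θ' x) x) (hsymm : ∀ x ∈ U, ∀ u v, θ' x u v = θ' x v u) :
    ∃ f : E → W, ∀ x ∈ U, HasFDerivAt f (θ x) x := by
  obtain ⟨f, hf⟩ := hU.exists_forall_hasFDerivWithinAt_of_hasFDerivWithinAt_symmetric
    (fun x hx => ((hθ x hx).restrictScalars ℝ).hasFDerivWithinAt)
    (fun x hx u _ v _ => hsymm x hx u v)
  exact ⟨f, fun x hx => (hf x hx).hasFDerivAt (hUo.mem_nhds hx)⟩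

/-- Existence of flat coordinates: a smooth symmetric connection `Γ` with vanishing curvature
admits local coordinates `y` with `∂ᵤ∂ᵥ y = Dy (Γ u v)` and prescribed differential at a point. -/
theorem exists_flat_coordinates [ProperSpace E] [CompleteSpace E] {U : Set E} (hU : IsOpen U)
    {c : E} (hc : c ∈ U) {Γ : E → E →L[𝕜] E →L[𝕜] E} (hΓ : ContDiffOn 𝕜 ∞ Γ U)
    (hsymm : ∀ x ∈ U, ∀ u v, Γ x u v = Γ x v u)
    (hcurv : ∀ x ∈ U, ∀ u v w, fderiv 𝕜 Γ x v u w + Γ x v (Γ x u w) =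
      fderiv 𝕜 Γ x u v w + Γ x u (Γ x v w)) (L : E →L[𝕜] E) :
    ∃ r > 0, ball c r ⊆ U ∧ ∃ y : E → E, ContDiffOn 𝕜 ∞ y (ball c r) ∧ fderiv 𝕜 y c = L ∧
      ∀ x ∈ ball c r, ∀ u v, fderiv 𝕜 (fderiv 𝕜 y) x u v = fderiv 𝕜 y x (Γ x u v) := by
  -- The unknown is `P = Dy`, with values in endomorphisms, and the system is `dP(u) = P ∘ Γ(u)`;
  -- `K` is composition with the arguments interchanged.
  set K : (E →L[𝕜] E) →L[𝕜] (E →L[𝕜] E) →L[𝕜] (E →L[𝕜] E) :=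
    (ContinuousLinearMap.compL 𝕜 E E E).flip with hK
  set B : E → E →L[𝕜] (E →L[𝕜] E) →L[𝕜] (E →L[𝕜] E) := fun x => K.comp (Γ x) with hBdef
  have hB : ContDiffOn 𝕜 ∞ B U := contDiffOn_const.clm_comp hΓ
  have hBapp : ∀ x u P w, B x u P w = P (Γ x u w) := fun x u P w => rfl
  have hΓd : ∀ x ∈ U, HasFDerivAt Γ (fderiv 𝕜 Γ x) x := fun x hx =>
    ((hΓ.contDiffAt (hU.mem_nhds hx)).differentiableAt (by simp)).hasFDerivAt
  have hBd : ∀ x ∈ U, HasFDerivAt B (fderiv 𝕜 B x) x := fun x hx =>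
    ((hB.contDiffAt (hU.mem_nhds hx)).differentiableAt (by simp)).hasFDerivAt
  have hB'app : ∀ x ∈ U, ∀ v u P w, fderiv 𝕜 B x v u P w = P (fderiv 𝕜 Γ x v u w) := by
    intro x hx v u P w
    have h1 := (hasFDerivAt_const K x).clm_comp (hΓd x hx)
    have h2 : fderiv 𝕜 B x = _ := h1.fderiv
    rw [h2]
    simp [hK]
  have hcont : ContinuousAt (fun x => ‖B x‖) c :=
    (hBd c hc).continuousAt.norm
  set b := ‖B c‖ + 1 with hb
  have hbpos : 0 < b := by positivity
  obtain ⟨r₀, hr₀, hr₀b⟩ := Metric.mem_nhds_iff.1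
    (Filter.inter_mem (hU.mem_nhds hc) (hcont.eventually (gt_mem_nhds (lt_add_one ‖B c‖))))
  -- The second entry ensures `b * r ≤ 1 / 4`, as the Picard iteration requires.
  set r := min r₀ (1 / (4 * b)) with hr
  have hrpos : 0 < r := lt_min hr₀ (by positivity)
  have hsub : ball c r ⊆ ball c r₀ := ball_subset_ball (min_le_left _ _)
  have hrU : ball c r ⊆ U := fun x hx => (hr₀b (hsub hx)).1
  have htr : ∀ x ∈ ball (0 : E) r, x + c ∈ ball c r := fun x hx => by
    simpa [mem_ball_iff_norm] using hx
  obtain ⟨P, hP0, hP⟩ := exists_hasFDerivAt_pfaffian (B := fun x => B (x + c)) (b := b)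
    (B' := fun x => fderiv 𝕜 B (x + c)) hrpos
    (fun x hx => (hasFDerivAt_comp_add_right c).2 (hBd _ (hrU (htr x hx))))
    (by
      have h1 : ContinuousOn (fderiv 𝕜 B) U := hB.continuousOn_fderiv_of_isOpen hU (by simp)
      exact h1.comp (by fun_prop) fun x hx => hrU (htr x hx))
    (fun x hx => (hr₀b (hsub (htr x hx))).2.le)
    (by
      calc b * r ≤ b * (1 / (4 * b)) := by gcongr; exact min_le_right _ _
        _ = 1 / 4 := by field_simp)
    (by
      intro x hx u v w
      have hx' := hrU (htr x hx)
      ext z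
      have := congrArg w (hcurv _ hx' u v z)
      simp only [map_add] at this
      simpa only [_root_.add_apply, hB'app _ hx', hBapp] using this) L
  set P' : E → E →L[𝕜] E := fun x => P (x - c) with hP'
  have hP'd : ∀ x ∈ ball c r, HasFDerivAt P' ((B x).flip (P' x)) x := by
    intro x hx
    have hx' : x - c ∈ ball (0 : E) r := by
      rwa [mem_ball_zero_iff, ← mem_ball_iff_norm]
    have := (hasFDerivAt_comp_sub c).2 (hP _ hx')
    simpa only [sub_add_cancel] using this
  -- Vanishing torsion (symmetry of `Γ`) is exactly closedness of the one-form `P'`.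
  obtain ⟨y, hy⟩ := exists_primitive_of_symmetric (convex_ball c r) isOpen_ball hP'd
    (by
      intro x hx u v
      simp only [ContinuousLinearMap.flip_apply, hBapp]
      rw [hsymm x (hrU hx)])
  have hP's : ContDiffOn 𝕜 ∞ P' (ball c r) :=
    contDiffOn_infty_of_pfaffian isOpen_ball (hB.mono hrU) hP'd
  refine ⟨r, hrpos, hrU, y, contDiffOn_infty_of_hasFDerivAt isOpen_ball hy hP's, ?_, ?_⟩
  · rw [(hy c (mem_ball_self hrpos)).fderiv]
    simp [hP', hP0]
  · intro x hx u v
    have h1 : fderiv 𝕜 y =ᶠ[nhds x] P' := by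
      filter_upwards [isOpen_ball.mem_nhds hx] with z hz using (hy z hz).fderiv
    rw [h1.fderiv_eq, (hP'd x hx).fderiv, (hy x hx).fderiv]
    rfl

end FlatCoordinates

/-! ### Iterated derivatives, Lie derivatives along affine fields, and polynomials of degree at most
two. -/

section DirectionalDerivatives

open Set

variable {𝕜 E W : Type*} [RCLike 𝕜] [NormedAddCommGroup E] [NormedSpace 𝕜 E]
  [NormedAddCommGroup W] [NormedSpace 𝕜 W] {U : Set E} {f g : E → W} {x : E}

variable (𝕜) in
/-- The derivative of `f` in the constant direction `v`. -/
noncomputable def dirDeriv (v : E) (f : E → W) (x : E) : W := fderiv 𝕜 f x v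

theorem ContDiffOn.differentiableAt_of_isOpen (hf : ContDiffOn 𝕜 ∞ f U) (hU : IsOpen U)
    (hx : x ∈ U) : DifferentiableAt 𝕜 f x :=
  (hf.contDiffAt (hU.mem_nhds hx)).differentiableAt (by simp)

theorem ContDiffOn.fderiv_infty (hf : ContDiffOn 𝕜 ∞ f U) (hU : IsOpen U) :
    ContDiffOn 𝕜 ∞ (fderiv 𝕜 f) U :=
  hf.fderiv_of_isOpen hU (by simp)

theorem ContDiffOn.dirDeriv (hf : ContDiffOn 𝕜 ∞ f U) (hU : IsOpen U) (v : E) :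
    ContDiffOn 𝕜 ∞ (dirDeriv 𝕜 v f) U :=
  (hf.fderiv_infty hU).clm_apply contDiffOn_const

theorem ContDiffOn.fderiv_fderiv_symm (hf : ContDiffOn 𝕜 ∞ f U) (hU : IsOpen U) (hx : x ∈ U)
    (u v : E) : fderiv 𝕜 (fderiv 𝕜 f) x u v = fderiv 𝕜 (fderiv 𝕜 f) x v u :=
  ((hf.contDiffAt (hU.mem_nhds hx)).isSymmSndFDerivAt
    (by rw [minSmoothness_of_isRCLikeNormedField]; exact ENat.LEInfty.out)) u v

theorem ContDiffOn.dirDeriv_dirDeriv (hf : ContDiffOn 𝕜 ∞ f U) (hU : IsOpen U) (hx : x ∈ U)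
    (u v : E) : _root_.dirDeriv 𝕜 u (_root_.dirDeriv 𝕜 v f) x = fderiv 𝕜 (fderiv 𝕜 f) x u v := by
  have h := ((hf.fderiv_infty hU).differentiableAt_of_isOpen hU hx).hasFDerivAt.clm_apply
    (hasFDerivAt_const v x)
  have h2 : fderiv 𝕜 (_root_.dirDeriv 𝕜 v f) x = _ := h.fderiv
  rw [_root_.dirDeriv, h2]
  simp

theorem dirDeriv_congr (hU : IsOpen U) (h : EqOn f g U) (v : E) :
    EqOn (dirDeriv 𝕜 v f) (dirDeriv 𝕜 v g) U := by
  intro x hx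
  have : f =ᶠ[nhds x] g := by filter_upwards [hU.mem_nhds hx] with y hy using h hy
  rw [dirDeriv, dirDeriv, this.fderiv_eq]

theorem ContDiffOn.dirDeriv_dirDeriv_dirDeriv (hf : ContDiffOn 𝕜 ∞ f U) (hU : IsOpen U)
    (hx : x ∈ U) (a b d : E) :
    _root_.dirDeriv 𝕜 a (_root_.dirDeriv 𝕜 b (_root_.dirDeriv 𝕜 d f)) x =
      fderiv 𝕜 (fderiv 𝕜 (fderiv 𝕜 f)) x a b d := by
  have h1 : EqOn (_root_.dirDeriv 𝕜 b (_root_.dirDeriv 𝕜 d f))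
      (fun y => fderiv 𝕜 (fderiv 𝕜 f) y b d) U := fun y hy => hf.dirDeriv_dirDeriv hU hy b d
  rw [dirDeriv_congr hU h1 a hx]
  have h := ((((hf.fderiv_infty hU).fderiv_infty hU).differentiableAt_of_isOpen hU
    hx).hasFDerivAt.clm_apply (hasFDerivAt_const b x)).clm_apply (hasFDerivAt_const d x)
  rw [_root_.dirDeriv, h.fderiv]
  simp

theorem dirDeriv_fun_add (hf : DifferentiableAt 𝕜 f x) (hg : DifferentiableAt 𝕜 g x) (v : E) :
    dirDeriv 𝕜 v (fun y => f y + g y) x = dirDeriv 𝕜 v f x + dirDeriv 𝕜 v g x := by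
  rw [dirDeriv, fderiv_fun_add hf hg]
  rfl

/-- The commutator of a directional derivative with the derivative along an affine field. -/
theorem ContDiffOn.dirDeriv_fderiv_apply (hf : ContDiffOn 𝕜 ∞ f U) (hU : IsOpen U) (hx : x ∈ U)
    {ξ : E → E} {A : E →L[𝕜] E} (hξ : ∀ y, HasFDerivAt ξ A y) (v : E) :
    _root_.dirDeriv 𝕜 v (fun y => fderiv 𝕜 f y (ξ y)) x =
      fderiv 𝕜 (_root_.dirDeriv 𝕜 v f) x (ξ x) + _root_.dirDeriv 𝕜 (A v) f x := by
  have h := ((hf.fderiv_infty hU).differentiableAt_of_isOpen hU hx).hasFDerivAt.clm_apply (hξ x)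
  have h2 := hf.dirDeriv_dirDeriv hU hx (ξ x) v
  rw [_root_.dirDeriv] at h2
  rw [h2, _root_.dirDeriv, h.fderiv, _root_.dirDeriv, hf.fderiv_fderiv_symm hU hx]
  simp [add_comm]

/-- The third derivative of the Lie derivative of a function along an affine field. -/
theorem ContDiffOn.third_fderiv_lie (hf : ContDiffOn 𝕜 ∞ f U) (hU : IsOpen U) (hx : x ∈ U)
    {ξ : E → E} {A : E →L[𝕜] E} (hξ : ∀ y, HasFDerivAt ξ A y) (a b d : E) :
    fderiv 𝕜 (fderiv 𝕜 (fderiv 𝕜 (fun y => fderiv 𝕜 f y (ξ y)))) x a b d =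
      fderiv 𝕜 (fderiv 𝕜 (fderiv 𝕜 (fderiv 𝕜 f))) x (ξ x) a b d +
      fderiv 𝕜 (fderiv 𝕜 (fderiv 𝕜 f)) x (A a) b d +
      fderiv 𝕜 (fderiv 𝕜 (fderiv 𝕜 f)) x a (A b) d +
      fderiv 𝕜 (fderiv 𝕜 (fderiv 𝕜 f)) x a b (A d) := by
  have hξs : ContDiff 𝕜 ∞ ξ := by
    rw [contDiff_infty_iff_fderiv]
    refine ⟨fun y => (hξ y).differentiableAt, ?_⟩
    rw [show fderiv 𝕜 ξ = fun _ => A from funext fun y => (hξ y).fderiv]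
    exact contDiff_const
  have hL : ∀ {h : E → W}, ContDiffOn 𝕜 ∞ h U →
      ContDiffOn 𝕜 ∞ (fun y => fderiv 𝕜 h y (ξ y)) U := fun hh =>
    (hh.fderiv_infty hU).clm_apply hξs.contDiffOn
  have hd := hf.dirDeriv hU d
  have hbd := hd.dirDeriv hU b
  have hAd := hf.dirDeriv hU (A d)
  -- Each of the three constant directions is commuted past the Lie derivative in turn, leaving one
  -- term with `A` applied to that direction.
  have e1 : EqOn (_root_.dirDeriv 𝕜 d (fun y => fderiv 𝕜 f y (ξ y)))
      (fun y => fderiv 𝕜 (_root_.dirDeriv 𝕜 d f) y (ξ y) + _root_.dirDeriv 𝕜 (A d) f y) U :=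
    fun y hy => hf.dirDeriv_fderiv_apply hU hy hξ d
  have e2 : EqOn (_root_.dirDeriv 𝕜 b (_root_.dirDeriv 𝕜 d (fun y => fderiv 𝕜 f y (ξ y))))
      (fun y => (fderiv 𝕜 (_root_.dirDeriv 𝕜 b (_root_.dirDeriv 𝕜 d f)) y (ξ y) +
        _root_.dirDeriv 𝕜 (A b) (_root_.dirDeriv 𝕜 d f) y) +
        _root_.dirDeriv 𝕜 b (_root_.dirDeriv 𝕜 (A d) f) y) U := by
    intro y hy
    rw [dirDeriv_congr hU e1 b hy, dirDeriv_fun_add ((hL hd).differentiableAt_of_isOpen hU hy)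
      (hAd.differentiableAt_of_isOpen hU hy), hd.dirDeriv_fderiv_apply hU hy hξ b]
  rw [← (hL hf).dirDeriv_dirDeriv_dirDeriv hU hx, dirDeriv_congr hU e2 a hx,
    dirDeriv_fun_add (((hL hbd).add (hd.dirDeriv hU (A b))).differentiableAt_of_isOpen hU hx)
      ((hAd.dirDeriv hU b).differentiableAt_of_isOpen hU hx),
    dirDeriv_fun_add ((hL hbd).differentiableAt_of_isOpen hU hx)
      ((hd.dirDeriv hU (A b)).differentiableAt_of_isOpen hU hx),
    hbd.dirDeriv_fderiv_apply hU hx hξ a]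
  simp only [hf.dirDeriv_dirDeriv_dirDeriv hU hx]
  congr 3
  have e3 : EqOn (_root_.dirDeriv 𝕜 a (_root_.dirDeriv 𝕜 b (_root_.dirDeriv 𝕜 d f)))
      (fun y => fderiv 𝕜 (fderiv 𝕜 (fderiv 𝕜 f)) y a b d) U :=
    fun y hy => hf.dirDeriv_dirDeriv_dirDeriv hU hy a b d
  have h3 := (((((hf.fderiv_infty hU).fderiv_infty hU).fderiv_infty hU).differentiableAt_of_isOpen
    hU hx).hasFDerivAt.clm_apply (hasFDerivAt_const a x)).clm_apply (hasFDerivAt_const b x)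
    |>.clm_apply (hasFDerivAt_const d x)
  have := dirDeriv_congr (𝕜 := 𝕜) hU e3 (ξ x) hx
  rw [_root_.dirDeriv, _root_.dirDeriv, h3.fderiv] at this
  rw [this]
  simp

/-- The third derivative of a quadratic polynomial vanishes. -/
theorem third_fderiv_quadratic (β : E →L[𝕜] E →L[𝕜] W) (B : E →L[𝕜] W) (C : W) (x a b d : E) :
    fderiv 𝕜 (fderiv 𝕜 (fderiv 𝕜 (fun y => β y y + B y + C))) x a b d = 0 := by
  have h1 : fderiv 𝕜 (fun y => β y y + B y + C) = fun y => β.flip y + β y + B := by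
    funext y
    have := ((β.hasFDerivAt (x := y)).clm_apply (hasFDerivAt_id (𝕜 := 𝕜) y)).add
      (B.hasFDerivAt (x := y)) |>.add_const C
    have h : fderiv 𝕜 (fun y => β y y + B y + C) y = _ := this.fderiv
    rw [h]
    ext z
    simp [add_comm]
  have h2 : fderiv 𝕜 (fun y => β.flip y + β y + B) = fun _ => β.flip + β := by
    funext y
    exact ((β.flip.hasFDerivAt.add β.hasFDerivAt).add_const B).fderiv
  rw [h1, h2]
  simp

/-- A function with vanishing second derivative on a connected open set is affine. -/
theorem exists_affine_of_fderiv_fderiv_eq_zero [NormedSpace ℝ E] (hU : IsOpen U) (hU' : IsPreconnected U)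
    (hf : ContDiffOn 𝕜 ∞ f U) (h : ∀ x ∈ U, ∀ u v, fderiv 𝕜 (fderiv 𝕜 f) x u v = 0) :
    ∃ (A : E →L[𝕜] W) (r : W), ∀ x ∈ U, f x = A x + r ∧ fderiv 𝕜 f x = A := by
  rcases U.eq_empty_or_nonempty with rfl | ⟨c, hc⟩
  · exact ⟨0, 0, by simp⟩
  have h1 : ∀ x ∈ U, fderiv 𝕜 f x = fderiv 𝕜 f c := fun x hx =>
    hU.is_const_of_fderiv_eq_zero hU' (hf.fderiv_infty hU |>.differentiableOn (by simp))
      (fun y hy => by ext u v; exact h y hy u v) hx hc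
  have h2 : ∀ x ∈ U, HasFDerivAt (fun y => f y - fderiv 𝕜 f c y) 0 x := fun x hx => by
    have := (hf.differentiableAt_of_isOpen hU hx).hasFDerivAt.sub (fderiv 𝕜 f c).hasFDerivAt
    rwa [h1 x hx, sub_self] at this
  refine ⟨fderiv 𝕜 f c, f c - fderiv 𝕜 f c c, fun x hx => ⟨?_, h1 x hx⟩⟩
  have := hU.is_const_of_fderiv_eq_zero hU'
    (fun y hy => (h2 y hy).differentiableAt.differentiableWithinAt)
    (fun y hy => (h2 y hy).fderiv) hx hc
  rw [← this]
  abel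

/-- A function with vanishing third derivative on a connected open set is a quadratic
polynomial. -/
theorem exists_quadratic_of_third_fderiv_eq_zero [NormedSpace ℝ E] (hU : IsOpen U) (hU' : IsPreconnected U)
    (hf : ContDiffOn 𝕜 ∞ f U)
    (h : ∀ x ∈ U, ∀ u v w, fderiv 𝕜 (fderiv 𝕜 (fderiv 𝕜 f)) x u v w = 0) :
    ∃ (β : E →L[𝕜] E →L[𝕜] W) (B : E →L[𝕜] W) (C : W), ∀ x ∈ U, f x = β x x + B x + C := by
  obtain ⟨A, r, hA⟩ := exists_affine_of_fderiv_fderiv_eq_zero hU hU' (hf.fderiv_infty hU)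
    fun x hx u v => by ext w; exact h x hx u v w
  have hsymm : ∀ x ∈ U, ∀ u v, A u v = A v u := fun x hx u v => by
    rw [← (hA x hx).2]; exact hf.fderiv_fderiv_symm hU hx u v
  -- Removing the quadratic part leaves a function with constant derivative; the symmetry of `A`
  -- makes the derivative of `A y y` equal to twice `A y`.
  set g : E → W := fun y => f y - (2⁻¹ : 𝕜) • A y y
  have hg : ∀ x ∈ U, HasFDerivAt g r x := by
    intro x hx
    have h1 := (hf.differentiableAt_of_isOpen hU hx).hasFDerivAt.sub
      (((A.hasFDerivAt (x := x)).clm_apply (hasFDerivAt_id (𝕜 := 𝕜) x)).const_smul (2⁻¹ : 𝕜))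
    refine h1.congr_fderiv ?_
    ext u
    rw [(hA x hx).1]
    simp only [_root_.sub_apply, _root_.add_apply, _root_.smul_apply, ContinuousLinearMap.comp_apply,
      ContinuousLinearMap.flip_apply, id_eq, ContinuousLinearMap.id_apply]
    rw [hsymm x hx u x, ← two_smul 𝕜, smul_smul]
    simp
  have hgs : ContDiffOn 𝕜 ∞ g U := contDiffOn_infty_of_hasFDerivAt hU hg contDiffOn_const
  have hg2 : ∀ x ∈ U, ∀ u v, fderiv 𝕜 (fderiv 𝕜 g) x u v = 0 := by
    intro x hx u v
    have : fderiv 𝕜 g =ᶠ[nhds x] fun _ => r := by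
      filter_upwards [hU.mem_nhds hx] with y hy using (hg y hy).fderiv
    rw [this.fderiv_eq]
    simp
  obtain ⟨B, C, hB⟩ := exists_affine_of_fderiv_fderiv_eq_zero hU hU' hgs hg2
  refine ⟨(2⁻¹ : 𝕜) • A, B, C, fun x hx => ?_⟩
  rw [add_assoc, ← (hB x hx).1]
  simp [g]

/-- The product rule for a trilinear form pulled back along `φ` and applied to vector fields. -/
theorem fderiv_trilinear_comp {G : Type*} [NormedAddCommGroup G] [NormedSpace 𝕜 G]
    {C : G → G →L[𝕜] G →L[𝕜] G →L[𝕜] W} {φ a b d : E → G}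
    (hC : DifferentiableAt 𝕜 C (φ x)) (hφ : DifferentiableAt 𝕜 φ x)
    (ha : DifferentiableAt 𝕜 a x) (hb : DifferentiableAt 𝕜 b x) (hd : DifferentiableAt 𝕜 d x)
    (u : E) :
    fderiv 𝕜 (fun y => C (φ y) (a y) (b y) (d y)) x u =
      fderiv 𝕜 C (φ x) (fderiv 𝕜 φ x u) (a x) (b x) (d x) +
      C (φ x) (fderiv 𝕜 a x u) (b x) (d x) + C (φ x) (a x) (fderiv 𝕜 b x u) (d x) +
      C (φ x) (a x) (b x) (fderiv 𝕜 d x u) := by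
  have h1 := hC.hasFDerivAt.comp x hφ.hasFDerivAt
  have h2 := ((h1.clm_apply ha.hasFDerivAt).clm_apply hb.hasFDerivAt).clm_apply hd.hasFDerivAt
  have h3 : fderiv 𝕜 (fun y => C (φ y) (a y) (b y) (d y)) x = _ := h2.fderiv
  rw [h3]
  simp
  abel

/-- The product rule for a constant bilinear form applied to vector fields. -/
theorem fderiv_bilinear_apply {G : Type*} [NormedAddCommGroup G] [NormedSpace 𝕜 G]
    (β : G →L[𝕜] G →L[𝕜] W) {a b : E → G} (ha : DifferentiableAt 𝕜 a x)
    (hb : DifferentiableAt 𝕜 b x) (u : E) :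
    fderiv 𝕜 (fun y => β (a y) (b y)) x u =
      β (fderiv 𝕜 a x u) (b x) + β (a x) (fderiv 𝕜 b x u) := by
  have h1 := ((β.hasFDerivAt (x := a x)).comp x ha.hasFDerivAt).clm_apply hb.hasFDerivAt
  have h3 : fderiv 𝕜 (fun y => β (a y) (b y)) x = _ := h1.fderiv
  rw [h3]
  simp [add_comm]

end DirectionalDerivatives

/-! ### Integrating a totally symmetric tensor three times. -/

section Potential

open Set Metric

variable {𝕜 E : Type*} [RCLike 𝕜] [NormedAddCommGroup E] [NormedSpace ℝ E] [NormedSpace 𝕜 E]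

/-- A smooth symmetric trilinear form with symmetric derivative is a third derivative. -/
theorem exists_third_potential {c : E} {r : ℝ} (hr : 0 < r)
    {C : E → E →L[𝕜] E →L[𝕜] E →L[𝕜] 𝕜} (hC : ContDiffOn 𝕜 ∞ C (ball c r))
    (h12 : ∀ x ∈ ball c r, ∀ a b d, C x a b d = C x b a d)
    (h23 : ∀ x ∈ ball c r, ∀ a b d, C x a b d = C x a d b)
    (hsymm : ∀ x ∈ ball c r, ∀ u v a b, fderiv 𝕜 C x u v a b = fderiv 𝕜 C x v u a b) :
    ∃ F : E → 𝕜, ContDiffOn 𝕜 ∞ F (ball c r) ∧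
      ∀ x ∈ ball c r, fderiv 𝕜 (fderiv 𝕜 (fderiv 𝕜 F)) x = C x := by
  have hU : IsOpen (ball c r) := isOpen_ball
  have hconv := convex_ball c r
  obtain ⟨b₀, hb₀⟩ := exists_primitive_of_symmetric hconv hU
    (fun x hx => (hC.differentiableAt_of_isOpen hU hx).hasFDerivAt)
    (fun x hx u v => by ext a b; exact hsymm x hx u v a b)
  -- Normalized to vanish at the centre: by `h23` the antisymmetric part of the primitive is
  -- constant, and now it is zero, so `b` can be the second derivative of a function.
  set b : E → E →L[𝕜] E →L[𝕜] 𝕜 := fun x => b₀ x - b₀ c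
  have hb : ∀ x ∈ ball c r, HasFDerivAt b (C x) x := fun x hx => (hb₀ x hx).sub_const _
  have hbsymm : ∀ x ∈ ball c r, ∀ u v, b x u v = b x v u := by
    intro x hx u v
    have hd : ∀ y ∈ ball c r, HasFDerivAt (fun z => b z u v - b z v u) (0 : E →L[𝕜] 𝕜) y := by
      intro y hy
      have h1 := ((hb y hy).clm_apply (hasFDerivAt_const u y)).clm_apply (hasFDerivAt_const v y)
      have h2 := ((hb y hy).clm_apply (hasFDerivAt_const v y)).clm_apply (hasFDerivAt_const u y)
      refine (h1.sub h2).congr_fderiv ?_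
      ext w
      simp [h23 y hy w u v]
    have := hU.is_const_of_fderiv_eq_zero hconv.isPreconnected
      (fun y hy => (hd y hy).differentiableAt.differentiableWithinAt)
      (fun y hy => (hd y hy).fderiv) hx (mem_ball_self hr)
    simp only [b, sub_self, _root_.zero_apply] at this
    exact sub_eq_zero.1 this
  obtain ⟨a, ha⟩ := exists_primitive_of_symmetric hconv hU hb
    (fun x hx u v => by ext d; exact h12 x hx u v d)
  obtain ⟨F, hF⟩ := exists_primitive_of_symmetric hconv hU ha hbsymm
  have hbs := contDiffOn_infty_of_hasFDerivAt hU hb hC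
  have has := contDiffOn_infty_of_hasFDerivAt hU ha hbs
  refine ⟨F, contDiffOn_infty_of_hasFDerivAt hU hF has, fun x hx => ?_⟩
  have e1 : ∀ y ∈ ball c r, fderiv 𝕜 F y = a y := fun y hy => (hF y hy).fderiv
  have e2 : ∀ y ∈ ball c r, fderiv 𝕜 (fderiv 𝕜 F) y = b y := fun y hy => by
    have : fderiv 𝕜 F =ᶠ[nhds y] a := by filter_upwards [hU.mem_nhds hy] with z hz using e1 z hz
    rw [this.fderiv_eq, (ha y hy).fderiv]
  have : fderiv 𝕜 (fderiv 𝕜 F) =ᶠ[nhds x] b := by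
    filter_upwards [hU.mem_nhds hx] with z hz using e2 z hz
  rw [this.fderiv_eq, (hb x hx).fderiv]

end Potential

/-! ### Symmetry and linearity of third derivatives. -/

section ThirdDerivatives

open Set

variable {𝕜 E W : Type*} [RCLike 𝕜] [NormedAddCommGroup E] [NormedSpace 𝕜 E]
  [NormedAddCommGroup W] [NormedSpace 𝕜 W] {U : Set E} {f g : E → W} {x : E}

theorem fderiv_eqOn (hU : IsOpen U) (h : EqOn f g U) : EqOn (fderiv 𝕜 f) (fderiv 𝕜 g) U := by
  intro x hx
  have : f =ᶠ[nhds x] g := by filter_upwards [hU.mem_nhds hx] with y hy using h hy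
  exact this.fderiv_eq

theorem third_fderiv_eqOn (hU : IsOpen U) (h : EqOn f g U) :
    EqOn (fderiv 𝕜 (fderiv 𝕜 (fderiv 𝕜 f))) (fderiv 𝕜 (fderiv 𝕜 (fderiv 𝕜 g))) U :=
  fderiv_eqOn hU (fderiv_eqOn hU (fderiv_eqOn hU h))

theorem ContDiffOn.fderiv_smul_add (hf : ContDiffOn 𝕜 ∞ f U) (hg : ContDiffOn 𝕜 ∞ g U)
    (hU : IsOpen U) (k : 𝕜) :
    EqOn (fderiv 𝕜 (fun y => k • f y + g y)) (fun y => k • fderiv 𝕜 f y + fderiv 𝕜 g y) U :=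
  fun _ hx => (((hf.differentiableAt_of_isOpen hU hx).hasFDerivAt.const_smul k).add
    (hg.differentiableAt_of_isOpen hU hx).hasFDerivAt).fderiv

theorem ContDiffOn.third_fderiv_smul_add (hf : ContDiffOn 𝕜 ∞ f U) (hg : ContDiffOn 𝕜 ∞ g U)
    (hU : IsOpen U) (k : 𝕜) (hx : x ∈ U) :
    fderiv 𝕜 (fderiv 𝕜 (fderiv 𝕜 (fun y => k • f y + g y))) x =
      k • fderiv 𝕜 (fderiv 𝕜 (fderiv 𝕜 f)) x + fderiv 𝕜 (fderiv 𝕜 (fderiv 𝕜 g)) x := by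
  rw [fderiv_eqOn hU (fderiv_eqOn hU (hf.fderiv_smul_add hg hU k)) hx,
    fderiv_eqOn hU ((hf.fderiv_infty hU).fderiv_smul_add (hg.fderiv_infty hU) hU k) hx,
    ((hf.fderiv_infty hU).fderiv_infty hU).fderiv_smul_add
      ((hg.fderiv_infty hU).fderiv_infty hU) hU k hx]

theorem ContDiffOn.third_fderiv_swap₁₂ (hf : ContDiffOn 𝕜 ∞ f U) (hU : IsOpen U) (hx : x ∈ U)
    (a b d : E) : fderiv 𝕜 (fderiv 𝕜 (fderiv 𝕜 f)) x a b d =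
      fderiv 𝕜 (fderiv 𝕜 (fderiv 𝕜 f)) x b a d := by
  rw [(hf.fderiv_infty hU).fderiv_fderiv_symm hU hx]

theorem ContDiffOn.third_fderiv_swap₂₃ (hf : ContDiffOn 𝕜 ∞ f U) (hU : IsOpen U) (hx : x ∈ U)
    (a b d : E) : fderiv 𝕜 (fderiv 𝕜 (fderiv 𝕜 f)) x a b d =
      fderiv 𝕜 (fderiv 𝕜 (fderiv 𝕜 f)) x a d b := by
  rw [← hf.dirDeriv_dirDeriv_dirDeriv hU hx, ← hf.dirDeriv_dirDeriv_dirDeriv hU hx]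
  refine dirDeriv_congr hU (fun y hy => ?_) a hx
  rw [hf.dirDeriv_dirDeriv hU hy, hf.dirDeriv_dirDeriv hU hy, hf.fderiv_fderiv_symm hU hy]

theorem ContDiffOn.fourth_fderiv_swap₁₂ (hf : ContDiffOn 𝕜 ∞ f U) (hU : IsOpen U) (hx : x ∈ U)
    (u a b d : E) : fderiv 𝕜 (fderiv 𝕜 (fderiv 𝕜 (fderiv 𝕜 f))) x u a b d =
      fderiv 𝕜 (fderiv 𝕜 (fderiv 𝕜 (fderiv 𝕜 f))) x a u b d := by
  rw [((hf.fderiv_infty hU).fderiv_infty hU).fderiv_fderiv_symm hU hx]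

end ThirdDerivatives

/-! ### Matrices and index sums as continuous multilinear maps. -/

section Coordinates

variable {𝕜 : Type*} [RCLike 𝕜] {m : ℕ}

/-- The bilinear form with matrix `A`, as a continuous bilinear map. -/
noncomputable def bilinCLM (A : Matrix (Fin m) (Fin m) 𝕜) :
    (Fin m → 𝕜) →L[𝕜] (Fin m → 𝕜) →L[𝕜] 𝕜 :=
  ∑ i, ∑ j, A i j • (ContinuousLinearMap.proj i : (Fin m → 𝕜) →L[𝕜] 𝕜).smulRight
    (ContinuousLinearMap.proj j : (Fin m → 𝕜) →L[𝕜] 𝕜)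

theorem bilinCLM_apply (A : Matrix (Fin m) (Fin m) 𝕜) (a b : Fin m → 𝕜) :
    bilinCLM A a b = metricForm A a b := by
  simp [bilinCLM, metricForm, mul_assoc]

/-- The linear map with matrix `q`, as a continuous linear map. -/
noncomputable def mulVecCLM (q : Matrix (Fin m) (Fin m) 𝕜) : (Fin m → 𝕜) →L[𝕜] (Fin m → 𝕜) :=
  LinearMap.toContinuousLinearMap (Matrix.mulVecLin q)

theorem affineField_eq (q : Matrix (Fin m) (Fin m) 𝕜) (r t : Fin m → 𝕜) :
    affineField q r t = mulVecCLM q t + r := by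
  ext i
  simp [affineField, mulVecCLM, Matrix.mulVec, dotProduct]

theorem mulVecCLM_single (q : Matrix (Fin m) (Fin m) 𝕜) (j i : Fin m) :
    mulVecCLM q (Pi.single j 1) i = q i j := by
  simp [mulVecCLM]

theorem exists_mulVecCLM_eq (A : (Fin m → 𝕜) →L[𝕜] (Fin m → 𝕜)) :
    ∃ q : Matrix (Fin m) (Fin m) 𝕜, mulVecCLM q = A :=
  ⟨LinearMap.toMatrix' A.toLinearMap, by
    ext x i
    have : Matrix.toLin' (LinearMap.toMatrix' A.toLinearMap) = A.toLinearMap :=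
      Matrix.toLin'_toMatrix' _
    exact congrFun (LinearMap.congr_fun this x) i⟩

theorem hasFDerivAt_affineField (q : Matrix (Fin m) (Fin m) 𝕜) (r t : Fin m → 𝕜) :
    HasFDerivAt (affineField q r) (mulVecCLM q) t := by
  rw [show affineField q r = fun t => mulVecCLM q t + r from funext (affineField_eq q r)]
  exact (mulVecCLM q).hasFDerivAt.add_const r

theorem clm_apply_eq_sum {W : Type*} [NormedAddCommGroup W] [NormedSpace 𝕜 W]
    (A : (Fin m → 𝕜) →L[𝕜] W) (a : Fin m → 𝕜) : A a = ∑ i, a i • A (Pi.single i 1) := by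
  conv_lhs => rw [pi_eq_sum_univ' a]
  simp

theorem sum_affineField_mul_coordDeriv (q : Matrix (Fin m) (Fin m) 𝕜) (r t : Fin m → 𝕜)
    (F : (Fin m → 𝕜) → 𝕜) :
    ∑ i, affineField q r t i * coordDeriv i F t = fderiv 𝕜 F t (affineField q r t) := by
  rw [clm_apply_eq_sum (fderiv 𝕜 F t)]
  rfl

theorem trilinear_apply_eq_sum (C : (Fin m → 𝕜) →L[𝕜] (Fin m → 𝕜) →L[𝕜] (Fin m → 𝕜) →L[𝕜] 𝕜)
    (a b d : Fin m → 𝕜) :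
    C a b d = ∑ i, ∑ j, ∑ k, a i * b j * d k *
      C (Pi.single i 1) (Pi.single j 1) (Pi.single k 1) := by
  rw [clm_apply_eq_sum C a]
  simp only [_root_.sum_apply, _root_.smul_apply]
  refine Finset.sum_congr rfl fun i _ => ?_
  rw [clm_apply_eq_sum (C (Pi.single i 1)) b]
  simp only [_root_.sum_apply, _root_.smul_apply, Finset.smul_sum]
  refine Finset.sum_congr rfl fun j _ => ?_
  rw [clm_apply_eq_sum (C (Pi.single i 1) (Pi.single j 1)) d]
  simp only [smul_eq_mul, Finset.mul_sum]
  refine Finset.sum_congr rfl fun k _ => ?_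
  ring

theorem thirdDeriv_eq_third_fderiv {F : (Fin m → 𝕜) → 𝕜} {U : Set (Fin m → 𝕜)} (hU : IsOpen U)
    (hF : ContDiffOn 𝕜 ∞ F U) {t : Fin m → 𝕜} (ht : t ∈ U) (i j k : Fin m) :
    thirdDeriv F i j k t = fderiv 𝕜 (fderiv 𝕜 (fderiv 𝕜 F)) t (Pi.single i 1) (Pi.single j 1)
      (Pi.single k 1) :=
  hF.dirDeriv_dirDeriv_dirDeriv hU ht _ _ _

theorem metricForm_eq_zero {η : Matrix (Fin m) (Fin m) 𝕜} (hη : IsUnit η.det) {a : Fin m → 𝕜}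
    (h : ∀ b, metricForm η a b = 0) : a = 0 := by
  have h1 : Matrix.vecMul a η = 0 := by
    ext j
    have := h (Pi.single j 1)
    simp only [metricForm, Pi.single_apply, mul_ite, mul_one, mul_zero, Finset.sum_ite_eq',
      Finset.mem_univ, if_true] at this
    simpa [Matrix.vecMul, dotProduct, mul_comm] using this
  have h2 : Matrix.vecMul (Matrix.vecMul a η) η⁻¹ = a := by
    rw [Matrix.vecMul_vecMul, Matrix.mul_nonsing_inv _ hη, Matrix.vecMul_one]
  rw [← h2, h1, Matrix.zero_vecMul]

theorem metricForm_comm {η : Matrix (Fin m) (Fin m) 𝕜} (hη : ∀ i j, η i j = η j i)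
    (a b : Fin m → 𝕜) : metricForm η a b = metricForm η b a := by
  simp only [metricForm]
  rw [Finset.sum_comm]
  refine Finset.sum_congr rfl fun i _ => Finset.sum_congr rfl fun j _ => ?_
  rw [hη j i]
  ring

/-- The defining property of the multiplication: `⟨a ∘ b, d⟩ = ∂_a ∂_b ∂_d F`. -/
theorem metricForm_prepotentialMul {η : Matrix (Fin m) (Fin m) 𝕜} (hη : IsUnit η.det)
    (hsymm : ∀ i j, η i j = η j i) {F : (Fin m → 𝕜) → 𝕜} {U : Set (Fin m → 𝕜)} (hU : IsOpen U)
    (hF : ContDiffOn 𝕜 ∞ F U) {t : Fin m → 𝕜} (ht : t ∈ U) (a b d : Fin m → 𝕜) :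
    metricForm η (prepotentialMul η F t a b) d = fderiv 𝕜 (fderiv 𝕜 (fderiv 𝕜 F)) t a b d := by
  have hmul : prepotentialMul η F t a b = Matrix.mulVec η⁻¹ fun l =>
      ∑ i, ∑ j, thirdDeriv F i j l t * a i * b j := by
    ext k
    simp only [prepotentialMul, Matrix.mulVec, dotProduct, Finset.mul_sum]
    rw [Finset.sum_comm]
    conv_rhs => rw [Finset.sum_comm]
    rw [Finset.sum_comm]
    refine Finset.sum_congr rfl fun i _ => ?_
    rw [Finset.sum_comm]
    refine Finset.sum_congr rfl fun j _ => Finset.sum_congr rfl fun l _ => ?_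
    ring
  rw [metricForm_comm hsymm]
  have hform : ∀ v, metricForm η d v = dotProduct d (Matrix.mulVec η v) := by
    intro v
    simp only [metricForm, Matrix.mulVec, dotProduct, Finset.mul_sum]
    refine Finset.sum_congr rfl fun i _ => Finset.sum_congr rfl fun j _ => ?_
    ring
  rw [hform, hmul, Matrix.mulVec_mulVec, Matrix.mul_nonsing_inv _ hη, Matrix.one_mulVec,
    trilinear_apply_eq_sum]
  simp only [dotProduct, Finset.mul_sum, thirdDeriv_eq_third_fderiv hU hF ht]
  rw [Finset.sum_comm]
  refine Finset.sum_congr rfl fun i _ => ?_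
  rw [Finset.sum_comm]
  refine Finset.sum_congr rfl fun j _ => Finset.sum_congr rfl fun l _ => ?_
  ring

end Coordinates

/-! ### Coordinate-free identities on a Frobenius manifold. -/

namespace FrobeniusManifold

open Set

variable {𝕜 : Type*} [RCLike 𝕜] {m : ℕ} [NeZero m] (M : FrobeniusManifold 𝕜 m)

/-- The third derivative `c(a, b, d)` of the prepotential at `t`. -/
noncomputable def third (t : Fin m → 𝕜) :
    (Fin m → 𝕜) →L[𝕜] (Fin m → 𝕜) →L[𝕜] (Fin m → 𝕜) →L[𝕜] 𝕜 :=
  fderiv 𝕜 (fderiv 𝕜 (fderiv 𝕜 M.F)) t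

variable {M} {t : Fin m → 𝕜}

theorem contDiffOn_third : ContDiffOn 𝕜 ∞ M.third M.region :=
  ((M.contDiffOn_F.fderiv_infty M.isOpen_region).fderiv_infty M.isOpen_region).fderiv_infty
    M.isOpen_region

theorem third_swap₁₂ (ht : t ∈ M.region) (a b d) : M.third t a b d = M.third t b a d :=
  M.contDiffOn_F.third_fderiv_swap₁₂ M.isOpen_region ht a b d

theorem third_swap₂₃ (ht : t ∈ M.region) (a b d) : M.third t a b d = M.third t a d b :=
  M.contDiffOn_F.third_fderiv_swap₂₃ M.isOpen_region ht a b d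

theorem fderiv_third_swap₁₂ (ht : t ∈ M.region) (u a b d) :
    fderiv 𝕜 M.third t u a b d = fderiv 𝕜 M.third t a u b d :=
  M.contDiffOn_F.fourth_fderiv_swap₁₂ M.isOpen_region ht u a b d

theorem thirdDeriv_eq (ht : t ∈ M.region) (i j k : Fin m) : thirdDeriv M.F i j k t =
    M.third t (Pi.single i 1) (Pi.single j 1) (Pi.single k 1) :=
  thirdDeriv_eq_third_fderiv M.isOpen_region M.contDiffOn_F ht i j k

variable (M) in
-- Symmetry is inherited from the partial derivatives of the prepotential through the normalization,
-- at any point of the nonempty region.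
theorem η_symm (i j : Fin m) : M.η i j = M.η j i := by
  obtain ⟨t, ht⟩ := M.isConnected_region.nonempty
  rw [← M.normalization t ht, ← M.normalization t ht, thirdDeriv_eq ht, thirdDeriv_eq ht,
    third_swap₂₃ ht]

variable (M) in
theorem metric_comm (a b) : M.metric a b = M.metric b a := metricForm_comm M.η_symm a b

variable (M) in
theorem eq_zero_of_metric {a} (h : ∀ b, M.metric a b = 0) : a = 0 :=
  metricForm_eq_zero M.nondegenerate h

theorem metric_mul (ht : t ∈ M.region) (a b d) : M.metric (M.mul t a b) d = M.third t a b d :=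
  metricForm_prepotentialMul M.nondegenerate M.η_symm M.isOpen_region M.contDiffOn_F ht a b d

variable (M) in
theorem metric_eq_bilinCLM (a b) : M.metric a b = bilinCLM M.η a b := (bilinCLM_apply _ _ _).symm

theorem third_unity (ht : t ∈ M.region) (a b) : M.third t M.unity a b = M.metric a b := by
  rw [← metric_mul ht, FrobeniusManifold.mul, FrobeniusManifold.unity, M.one_mul' t ht]

/-- By `third_unity` the function being differentiated is the metric, which has constant
coefficients. -/
theorem fderiv_third_unity (ht : t ∈ M.region) (u a b) :
    fderiv 𝕜 M.third t u M.unity a b = 0 := by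
  have h := fderiv_trilinear_comp (𝕜 := 𝕜) (C := M.third) (φ := id) (a := fun _ => M.unity)
    (b := fun _ => a) (d := fun _ => b) (x := t)
    (contDiffOn_third.differentiableAt_of_isOpen M.isOpen_region ht) differentiableAt_id
    (differentiableAt_const _) (differentiableAt_const _) (differentiableAt_const _) u
  have h2 : EqOn (fun y => M.third (id y) M.unity a b) (fun _ => M.metric a b) M.region :=
    fun y hy => third_unity hy a b
  rw [fderiv_eqOn M.isOpen_region h2 ht] at h
  simpa using h.symm

/-- Quasihomogeneity of the third derivatives of the prepotential. -/
theorem fderiv_third_euler (ht : t ∈ M.region) (a b d) :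
    fderiv 𝕜 M.third t (M.euler t) a b d + M.third t (mulVecCLM M.q a) b d +
      M.third t a (mulVecCLM M.q b) d + M.third t a b (mulVecCLM M.q d) =
      M.dF * M.third t a b d := by
  have h1 := M.contDiffOn_F.third_fderiv_lie M.isOpen_region ht
    (hasFDerivAt_affineField M.q M.r) a b d
  obtain ⟨A, B, C, h⟩ := M.quasihomogeneous
  -- The free polynomial has degree at most two, so it disappears after three differentiations.
  have h2 : EqOn (fun y => fderiv 𝕜 M.F y (affineField M.q M.r y)) (fun y => M.dF • M.F y +
      (bilinCLM A y y + (∑ i, B i • ContinuousLinearMap.proj (R := 𝕜) i :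
        (Fin m → 𝕜) →L[𝕜] 𝕜) y + C)) M.region := by
    intro y hy
    simp only
    rw [← sum_affineField_mul_coordDeriv, h y hy, bilinCLM_apply]
    simp [metricForm]
  rw [third_fderiv_eqOn M.isOpen_region h2 ht,
    M.contDiffOn_F.third_fderiv_smul_add (ContDiff.contDiffOn (by fun_prop)) M.isOpen_region
      _ ht] at h1
  simp only [_root_.add_apply, third_fderiv_quadratic, _root_.smul_apply, add_zero] at h1
  exact h1.symm

/-- Quasihomogeneity with the unity in the first slot. As `mulVecCLM M.q M.unity` is the bracket
`[𝕀, E]`, this computes the Lie derivative of the metric along `E`, which controls the Euler field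
on the submanifold. -/
theorem third_euler_unity (ht : t ∈ M.region) (a b) :
    M.third t (mulVecCLM M.q M.unity) a b + M.metric (mulVecCLM M.q a) b +
      M.metric a (mulVecCLM M.q b) = M.dF * M.metric a b := by
  have h := fderiv_third_euler ht M.unity a b
  rwa [fderiv_third_unity ht, third_unity ht, third_unity ht, third_unity ht, zero_add] at h

end FrobeniusManifold

/-! ### Composition, local inverses, and lifting of tangent fields along immersions. -/

section Charts

open Set Metric

variable {𝕜 E G W : Type*} [RCLike 𝕜] [NormedAddCommGroup E] [NormedSpace 𝕜 E]
  [NormedAddCommGroup G] [NormedSpace 𝕜 G] [NormedAddCommGroup W] [NormedSpace 𝕜 W]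

/-- The second derivative of a composition. -/
theorem fderiv_fderiv_comp {U : Set E} {V : Set G} (hU : IsOpen U) (hV : IsOpen V) {z : E → G}
    {φ : G → W} (hz : ContDiffOn 𝕜 ∞ z U) (hφ : ContDiffOn 𝕜 ∞ φ V) (hm : MapsTo z U V) {x : E}
    (hx : x ∈ U) (u v : E) :
    fderiv 𝕜 (fderiv 𝕜 (φ ∘ z)) x u v =
      fderiv 𝕜 (fderiv 𝕜 φ) (z x) (fderiv 𝕜 z x u) (fderiv 𝕜 z x v) +
        fderiv 𝕜 φ (z x) (fderiv 𝕜 (fderiv 𝕜 z) x u v) := by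
  have h1 : EqOn (fderiv 𝕜 (φ ∘ z)) (fun y => (fderiv 𝕜 φ (z y)).comp (fderiv 𝕜 z y)) U :=
    fun y hy => fderiv_comp y (hφ.differentiableAt_of_isOpen hV (hm hy))
      (hz.differentiableAt_of_isOpen hU hy)
  have h2 := ((hφ.fderiv_infty hV).differentiableAt_of_isOpen hV (hm hx)).hasFDerivAt.comp x
    (hz.differentiableAt_of_isOpen hU hx).hasFDerivAt
  have h3 := h2.clm_comp ((hz.fderiv_infty hU).differentiableAt_of_isOpen hU hx).hasFDerivAt
  rw [fderiv_eqOn hU h1 hx]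
  have h4 : fderiv 𝕜 (fun y => (fderiv 𝕜 φ (z y)).comp (fderiv 𝕜 z y)) x = _ := h3.fderiv
  rw [h4]
  simp [add_comm]

/-- The inverse function theorem on a ball. -/
theorem exists_local_inverse [CompleteSpace E] {U : Set E} (hU : IsOpen U) {y : E → E}
    (hy : ContDiffOn 𝕜 ∞ y U) {c : E} (hc : c ∈ U) (L : E ≃L[𝕜] E)
    (hL : fderiv 𝕜 y c = (L : E →L[𝕜] E)) :
    ∃ ρ > 0, ∃ z : E → E, ContDiffOn 𝕜 ∞ z (ball (y c) ρ) ∧ MapsTo z (ball (y c) ρ) U ∧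
      z (y c) = c ∧ (∀ p ∈ ball (y c) ρ, y (z p) = p) ∧
      (∀ p ∈ ball (y c) ρ, Function.Injective (fderiv 𝕜 y (z p))) ∧
      ∀ O ⊆ ball (y c) ρ, IsOpen O → IsOpen (z '' O) := by
  have hyc : ContDiffAt 𝕜 ∞ y c := hy.contDiffAt (hU.mem_nhds hc)
  have hLc : HasFDerivAt y (L : E →L[𝕜] E) c := by
    rw [← hL]; exact (hyc.differentiableAt (by simp)).hasFDerivAt
  set e := hyc.toOpenPartialHomeomorph y hLc (by simp) with he
  have hey : ∀ x, e x = y x := fun x => rfl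
  have hces : c ∈ e.source := hyc.mem_toOpenPartialHomeomorph_source hLc (by simp)
  have hcont : ContinuousAt (fderiv 𝕜 y) c :=
    ((hy.fderiv_infty hU).contDiffAt (hU.mem_nhds hc)).continuousAt
  have hinv : ∀ᶠ x in nhds c, fderiv 𝕜 y x ∈ range ((↑) : (E ≃L[𝕜] E) → E →L[𝕜] E) :=
    hcont.eventually (by rw [hL]; exact L.nhds)
  have hS : ∀ᶠ x in nhds c, x ∈ U ∧ fderiv 𝕜 y x ∈ range ((↑) : (E ≃L[𝕜] E) → E →L[𝕜] E) :=
    (hU.eventually_mem hc).and hinv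
  have hyct : y c ∈ e.target := e.map_source hces
  have hsymm : e.symm (y c) = c := e.left_inv hces
  have hT : ∀ᶠ p in nhds (y c), p ∈ e.target ∧ e.symm p ∈ U ∧
      fderiv 𝕜 y (e.symm p) ∈ range ((↑) : (E ≃L[𝕜] E) → E →L[𝕜] E) := by
    have ht : Filter.Tendsto e.symm (nhds (y c)) (nhds c) := by
      have := e.continuousAt_symm hyct
      rwa [ContinuousAt, hsymm] at this
    exact (e.open_target.eventually_mem hyct).and (ht.eventually hS)
  obtain ⟨ρ, hρ, hball⟩ := Metric.eventually_nhds_iff_ball.1 hT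
  refine ⟨ρ, hρ, e.symm, fun p hp => ?_, fun p hp => (hball p hp).2.1, hsymm,
    fun p hp => e.right_inv (hball p hp).1, fun p hp => ?_, fun O hO hOo => ?_⟩
  · obtain ⟨h1, h2, L', hL'⟩ := hball p hp
    have h3 : ContDiffAt 𝕜 ∞ y (e.symm p) := hy.contDiffAt (hU.mem_nhds h2)
    refine (e.contDiffAt_symm (f₀' := L') h1 ?_ h3).contDiffWithinAt
    rw [hL']
    exact (h3.differentiableAt (by simp)).hasFDerivAt
  · obtain ⟨-, -, L', hL'⟩ := hball p hp
    rw [← hL']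
    exact L'.injective
  · exact e.symm.isOpen_image_of_subset_source hOo fun p hp => (hball p (hO hp)).1

theorem exists_clm_leftInverse [FiniteDimensional 𝕜 G] {A : E →L[𝕜] G}
    (hA : Function.Injective A) : ∃ π : G →L[𝕜] E, π.comp A = ContinuousLinearMap.id 𝕜 E := by
  obtain ⟨g, hg⟩ := A.toLinearMap.exists_leftInverse_of_injective (LinearMap.ker_eq_bot.2 hA)
  exact ⟨LinearMap.toContinuousLinearMap g, by ext x; exact LinearMap.congr_fun hg x⟩

/-- A smooth vector field along an immersion `φ` which is tangent to `φ` is the image of a smooth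
vector field. -/
theorem exists_lift_of_mem_range [CompleteSpace E] [FiniteDimensional 𝕜 G] {V : Set E}
    (hV : IsOpen V) {φ : E → G} (hφ : ContDiffOn 𝕜 ∞ φ V)
    (hinj : ∀ x ∈ V, Function.Injective (fderiv 𝕜 φ x)) {w : E → G} (hw : ContDiffOn 𝕜 ∞ w V)
    (hmem : ∀ x ∈ V, ∃ a, fderiv 𝕜 φ x a = w x) :
    ∃ ξ : E → E, ContDiffOn 𝕜 ∞ ξ V ∧ ∀ x ∈ V, fderiv 𝕜 φ x (ξ x) = w x := by
  have hmem' : ∀ x, ∃ a, x ∈ V → fderiv 𝕜 φ x a = w x := fun x => by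
    by_cases hx : x ∈ V
    · obtain ⟨a, ha⟩ := hmem x hx
      exact ⟨a, fun _ => ha⟩
    · exact ⟨0, fun h => (hx h).elim⟩
  choose ξ hξ using hmem'
  refine ⟨ξ, fun c hc => ContDiffAt.contDiffWithinAt ?_, hξ⟩
  -- `π` is a left inverse at `c` only, but `π ∘ Dφ` stays invertible nearby; there the lift is `(π
  -- ∘ Dφ)⁻¹ (π w)`, which is visibly smooth.
  obtain ⟨π, hπ⟩ := exists_clm_leftInverse (hinj c hc)
  set T : E → E →L[𝕜] E := fun x => π.comp (fderiv 𝕜 φ x) with hT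
  have hTs : ContDiffAt 𝕜 ∞ T c :=
    contDiffAt_const.clm_comp ((hφ.fderiv_infty hV).contDiffAt (hV.mem_nhds hc))
  have hTc : T c = ((1 : (E →L[𝕜] E)ˣ) : E →L[𝕜] E) := hπ
  have hinvs : ContDiffAt 𝕜 ∞ (fun x => Ring.inverse (T x)) c := by
    refine ContDiffAt.comp (g := Ring.inverse) c ?_ hTs
    rw [hTc]
    exact contDiffAt_ringInverse 𝕜 _
  have hunit : ∀ᶠ x in nhds c, IsUnit (T x) := by
    refine hTs.continuousAt.eventually ?_
    rw [hTc]
    exact Units.nhds _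
  have hπw : ContDiffAt 𝕜 ∞ (fun x => π (w x)) c :=
    π.contDiff.contDiffAt.comp c (hw.contDiffAt (hV.mem_nhds hc))
  refine (hinvs.clm_apply hπw).congr_of_eventuallyEq ?_
  filter_upwards [hunit, hV.mem_nhds hc] with x hx hxV
  rw [← hξ x hxV]
  change ξ x = (Ring.inverse (T x) * T x) (ξ x)
  rw [Ring.inverse_mul_cancel _ hx]
  rfl

end Charts

/-! ### Local parametrizations and tangent spaces. -/

section LocalParam

open Set

variable {𝕜 : Type*} [RCLike 𝕜] {m n : ℕ} {N : Set (Fin m → 𝕜)} {V V' : Set (Fin n → 𝕜)}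
  {φ ψ : (Fin n → 𝕜) → (Fin m → 𝕜)}

theorem IsLocalParam.mem (h : IsLocalParam N V φ) {τ : Fin n → 𝕜} (hτ : τ ∈ V) : φ τ ∈ N := by
  obtain ⟨O, -, hO⟩ := h.isOpen_image V subset_rfl h.isOpen
  exact (hO ▸ mem_image_of_mem φ hτ : φ τ ∈ N ∩ O).1

/-- Near `τ` one has `φ = ψ ∘ g ∘ π ∘ φ`, where `π` is a linear left inverse of `Dψ` and `g` a local
inverse of `π ∘ ψ`; the chain rule then factors `Dφ` through `Dψ`. That `ψ` is open into `N`
guarantees that nearby values of `φ` lie in the image of `ψ`. -/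
theorem IsLocalParam.range_fderiv_le (hφ : IsLocalParam N V φ) (hψ : IsLocalParam N V' ψ)
    {τ σ : Fin n → 𝕜} (hτ : τ ∈ V) (hσ : σ ∈ V') (hx : φ τ = ψ σ) (u : Fin n → 𝕜) :
    ∃ v, fderiv 𝕜 ψ σ v = fderiv 𝕜 φ τ u := by
  obtain ⟨π, hπ⟩ := exists_clm_leftInverse (hψ.injective_fderiv σ hσ)
  have hψσ : ContDiffAt 𝕜 ∞ ψ σ := hψ.contDiffOn.contDiffAt (hψ.isOpen.mem_nhds hσ)
  have hφτ := hφ.contDiffOn.differentiableAt_of_isOpen hφ.isOpen hτ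
  have hstrict : HasStrictFDerivAt (fun s => π (ψ s))
      ((ContinuousLinearEquiv.refl 𝕜 (Fin n → 𝕜) : (Fin n → 𝕜) →L[𝕜] (Fin n → 𝕜))) σ := by
    have := π.hasStrictFDerivAt.comp σ (hψσ.hasStrictFDerivAt (by simp))
    rwa [hπ] at this
  set g := hstrict.localInverse with hg
  have hleft : ∀ᶠ s in nhds σ, g (π (ψ s)) = s := hstrict.eventually_left_inverse
  have hgd := hstrict.to_localInverse.hasFDerivAt
  obtain ⟨W, hWsub, hWo, hσW⟩ := mem_nhds_iff.1
    (Filter.inter_mem hleft (hψ.isOpen.mem_nhds hσ))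
  obtain ⟨O, hOo, hO⟩ := hψ.isOpen_image W (fun s hs => (hWsub hs).2) hWo
  have hτO : φ τ ∈ O := by
    have : ψ σ ∈ N ∩ O := hO ▸ mem_image_of_mem ψ hσW
    rw [hx]; exact this.2
  have hev : φ =ᶠ[nhds τ] fun t => ψ (g (π (φ t))) := by
    filter_upwards [hφτ.continuousAt.eventually (hOo.mem_nhds hτO), hφ.isOpen.mem_nhds hτ]
      with t ht htV
    have : φ t ∈ ψ '' W := hO ▸ ⟨hφ.mem htV, ht⟩
    obtain ⟨s, hs, hst⟩ := this
    have h1 : g (π (ψ s)) = s := (hWsub hs).1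
    rw [← hst, h1]
  have hgσ : g (π (φ τ)) = σ := by rw [hx]; exact hleft.self_of_nhds
  have hgd' : HasFDerivAt g
      ((ContinuousLinearEquiv.refl 𝕜 (Fin n → 𝕜)).symm : (Fin n → 𝕜) →L[𝕜] (Fin n → 𝕜))
      (π (φ τ)) := by rw [hx]; exact hgd
  have h1 := hgd'.comp τ ((π.hasFDerivAt (x := φ τ)).comp τ hφτ.hasFDerivAt)
  have h2 : HasFDerivAt ψ (fderiv 𝕜 ψ σ) (g (π (φ τ))) := by
    rw [hgσ]; exact (hψσ.differentiableAt (by simp)).hasFDerivAt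
  have h3 := (h2.comp τ h1).congr_of_eventuallyEq hev
  rw [h3.fderiv]
  exact ⟨_, rfl⟩

/-- All parametrizations through a point have the same image of the differential, so the span in the
definition collapses to any one of them. -/
theorem IsLocalParam.mem_tangent_iff (h : IsLocalParam N V φ) {τ : Fin n → 𝕜} (hτ : τ ∈ V)
    {v : Fin m → 𝕜} : v ∈ submanifoldTangent n N (φ τ) ↔ ∃ u, fderiv 𝕜 φ τ u = v := by
  constructor
  · intro hv
    have : submanifoldTangent n N (φ τ) ≤ LinearMap.range (fderiv 𝕜 φ τ).toLinearMap := by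
      refine Submodule.span_le.2 ?_
      rintro w ⟨V', ψ, σ, hψ, hσ, hx, u, rfl⟩
      exact hψ.range_fderiv_le h hσ hτ hx u
    exact this hv
  · rintro ⟨u, rfl⟩
    exact Submodule.subset_span ⟨V, φ, τ, h, hτ, rfl, u, rfl⟩

/-- A local parametrization, reparametrized. -/
theorem IsLocalParam.comp (h : IsLocalParam N V φ) {U : Set (Fin n → 𝕜)} (hU : IsOpen U)
    {z : (Fin n → 𝕜) → (Fin n → 𝕜)} (hz : ContDiffOn 𝕜 ∞ z U) (hm : MapsTo z U V)
    (hinj : InjOn z U) (hinj' : ∀ p ∈ U, Function.Injective (fderiv 𝕜 z p))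
    (hopen : ∀ O ⊆ U, IsOpen O → IsOpen (z '' O)) : IsLocalParam N U (φ ∘ z) where
  isOpen := hU
  contDiffOn := h.contDiffOn.comp hz hm
  injective_fderiv p hp := by
    rw [fderiv_comp p (h.contDiffOn.differentiableAt_of_isOpen h.isOpen (hm hp))
      (hz.differentiableAt_of_isOpen hU hp)]
    exact (h.injective_fderiv _ (hm hp)).comp (hinj' p hp)
  injOn := h.injOn.comp hinj hm
  isOpen_image O hO hOo := by
    rw [image_comp]
    exact h.isOpen_image _ ((image_mono hO).trans (image_subset_iff.2 hm)) (hopen O hO hOo)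

end LocalParam

/-! ### Tangent immersions in flat coordinates: the unity and the Euler field. -/

section InducedGeometry

open Set

variable {𝕜 : Type*} [RCLike 𝕜] {m n : ℕ} [NeZero m] {M : FrobeniusManifold 𝕜 m}
  {V : Set (Fin n → 𝕜)} {φ : (Fin n → 𝕜) → (Fin m → 𝕜)}

/-- An immersion `φ : V → M` with nondegenerate induced metric, to which the unity, the products
of tangent vectors and the Euler field are tangent. -/
structure IsTangentImmersion (M : FrobeniusManifold 𝕜 m) (V : Set (Fin n → 𝕜))
    (φ : (Fin n → 𝕜) → (Fin m → 𝕜)) : Prop where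
  isOpen : IsOpen V
  contDiffOn : ContDiffOn 𝕜 ∞ φ V
  injective_fderiv : ∀ τ ∈ V, Function.Injective (fderiv 𝕜 φ τ)
  mapsTo : MapsTo φ V M.region
  nondegenerate : ∀ τ ∈ V, IsUnit (inducedMetric M φ τ).det
  mul_mem : ∀ τ ∈ V, ∀ a b, ∃ u, fderiv 𝕜 φ τ u = M.mul (φ τ) (fderiv 𝕜 φ τ a) (fderiv 𝕜 φ τ b)
  unity_mem : ∀ τ ∈ V, ∃ u, fderiv 𝕜 φ τ u = M.unity
  euler_mem : ∀ τ ∈ V, ∃ u, fderiv 𝕜 φ τ u = M.euler (φ τ)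

/-- The second derivative of `φ` is orthogonal to the tangent spaces of `φ`: the coordinates given
by `φ` are flat. -/
def HasNormalSecondDeriv (M : FrobeniusManifold 𝕜 m) (V : Set (Fin n → 𝕜))
    (φ : (Fin n → 𝕜) → (Fin m → 𝕜)) : Prop :=
  ∀ τ ∈ V, ∀ u v w, M.metric (fderiv 𝕜 (fderiv 𝕜 φ) τ u v) (fderiv 𝕜 φ τ w) = 0

namespace FrobeniusManifold

variable (M) in
theorem metric_add_left (a b d) : M.metric (a + b) d = M.metric a d + M.metric b d := by
  simp [metric_eq_bilinCLM]

variable (M) in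
theorem metric_sub_left (a b d) : M.metric (a - b) d = M.metric a d - M.metric b d := by
  simp [metric_eq_bilinCLM]

end FrobeniusManifold

theorem metricForm_inducedMetric (τ a b : Fin n → 𝕜) :
    metricForm (inducedMetric M φ τ) a b = M.metric (fderiv 𝕜 φ τ a) (fderiv 𝕜 φ τ b) := by
  rw [M.metric_eq_bilinCLM, clm_apply_eq_sum (fderiv 𝕜 φ τ) a, clm_apply_eq_sum (fderiv 𝕜 φ τ) b]
  simp only [metricForm, inducedMetric, M.metric_eq_bilinCLM, map_sum, map_smul, _root_.sum_apply,
    _root_.smul_apply, smul_eq_mul, Finset.mul_sum]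
  rw [Finset.sum_comm]
  refine Finset.sum_congr rfl fun i _ => Finset.sum_congr rfl fun j _ => ?_
  ring

/-- The derivative of the pulled back metric. -/
theorem fderiv_metric_fderiv (hV : IsOpen V) (hφ : ContDiffOn 𝕜 ∞ φ V) {τ : Fin n → 𝕜}
    (hτ : τ ∈ V) (u v w : Fin n → 𝕜) :
    fderiv 𝕜 (fun σ => M.metric (fderiv 𝕜 φ σ u) (fderiv 𝕜 φ σ v)) τ w =
      M.metric (fderiv 𝕜 (fderiv 𝕜 φ) τ w u) (fderiv 𝕜 φ τ v) +
        M.metric (fderiv 𝕜 φ τ u) (fderiv 𝕜 (fderiv 𝕜 φ) τ w v) := by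
  simp only [M.metric_eq_bilinCLM]
  have h : ∀ a, DifferentiableAt 𝕜 (fun σ => fderiv 𝕜 φ σ a) τ := fun a =>
    (hφ.dirDeriv hV a).differentiableAt_of_isOpen hV hτ
  have e : ∀ a, fderiv 𝕜 (fun σ => fderiv 𝕜 φ σ a) τ w = fderiv 𝕜 (fderiv 𝕜 φ) τ w a :=
    fun a => hφ.dirDeriv_dirDeriv hV hτ w a
  rw [fderiv_bilinear_apply (bilinCLM M.η) (h u) (h v), e, e]

/-- The Koszul formula for the second derivative of `φ`. -/
theorem metric_second_fderiv (hV : IsOpen V) (hφ : ContDiffOn 𝕜 ∞ φ V) {τ : Fin n → 𝕜}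
    (hτ : τ ∈ V) (u v w : Fin n → 𝕜) :
    M.metric (fderiv 𝕜 (fderiv 𝕜 φ) τ u v) (fderiv 𝕜 φ τ w) = 1 / 2 *
      (fderiv 𝕜 (fun σ => M.metric (fderiv 𝕜 φ σ w) (fderiv 𝕜 φ σ v)) τ u +
        fderiv 𝕜 (fun σ => M.metric (fderiv 𝕜 φ σ w) (fderiv 𝕜 φ σ u)) τ v -
        fderiv 𝕜 (fun σ => M.metric (fderiv 𝕜 φ σ u) (fderiv 𝕜 φ σ v)) τ w) := by
  simp only [fderiv_metric_fderiv hV hφ hτ]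
  rw [hφ.fderiv_fderiv_symm hV hτ v w, hφ.fderiv_fderiv_symm hV hτ v u,
    hφ.fderiv_fderiv_symm hV hτ w u, M.metric_comm (fderiv 𝕜 φ τ w),
    M.metric_comm (fderiv 𝕜 φ τ u)]
  ring

/-- Every term of the Koszul formula is a derivative of the induced metric, hence zero. -/
theorem hasNormalSecondDeriv_of_const (hV : IsOpen V) (hφ : ContDiffOn 𝕜 ∞ φ V)
    {g : Matrix (Fin n) (Fin n) 𝕜} (hg : ∀ τ ∈ V, inducedMetric M φ τ = g) :
    HasNormalSecondDeriv M V φ := by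
  intro τ hτ u v w
  have h0 : ∀ a b d, fderiv 𝕜 (fun σ => M.metric (fderiv 𝕜 φ σ a) (fderiv 𝕜 φ σ b)) τ d = 0 := by
    intro a b d
    have : EqOn (fun σ => M.metric (fderiv 𝕜 φ σ a) (fderiv 𝕜 φ σ b))
        (fun _ => metricForm g a b) V := fun σ hσ => by
      simp only [← metricForm_inducedMetric, hg σ hσ]
    rw [fderiv_eqOn hV this hτ]
    simp
  rw [metric_second_fderiv hV hφ hτ, h0, h0, h0]
  simp

namespace IsTangentImmersion

variable {τ : Fin n → 𝕜}

theorem eq_zero_of_metric (h : IsTangentImmersion M V φ) (hτ : τ ∈ V) {a : Fin n → 𝕜}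
    (ha : ∀ b, M.metric (fderiv 𝕜 φ τ a) (fderiv 𝕜 φ τ b) = 0) : a = 0 :=
  metricForm_eq_zero (h.nondegenerate τ hτ) fun b => by rw [metricForm_inducedMetric, ha]

/-- Differentiating `Dφ ξ = w`. -/
theorem fderiv_lift (h : IsTangentImmersion M V φ) {ξ : (Fin n → 𝕜) → (Fin n → 𝕜)} (hξ : ContDiffOn 𝕜 ∞ ξ V)
    {w : (Fin n → 𝕜) → (Fin m → 𝕜)} (hw : ∀ τ ∈ V, fderiv 𝕜 φ τ (ξ τ) = w τ) (hτ : τ ∈ V)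
    (u : Fin n → 𝕜) : fderiv 𝕜 w τ u =
      fderiv 𝕜 (fderiv 𝕜 φ) τ u (ξ τ) + fderiv 𝕜 φ τ (fderiv 𝕜 ξ τ u) := by
  have h1 := ((h.contDiffOn.fderiv_infty h.isOpen).differentiableAt_of_isOpen h.isOpen
    hτ).hasFDerivAt.clm_apply (hξ.differentiableAt_of_isOpen h.isOpen hτ).hasFDerivAt
  have h2 : EqOn w (fun σ => fderiv 𝕜 φ σ (ξ σ)) V := fun σ hσ => (hw σ hσ).symm
  rw [fderiv_eqOn h.isOpen h2 hτ, h1.fderiv]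
  simp [add_comm]

theorem exists_unity_lift (h : IsTangentImmersion M V φ) : ∃ e : (Fin n → 𝕜) → (Fin n → 𝕜), ContDiffOn 𝕜 ∞ e V ∧
    ∀ τ ∈ V, fderiv 𝕜 φ τ (e τ) = M.unity :=
  exists_lift_of_mem_range h.isOpen h.contDiffOn h.injective_fderiv contDiffOn_const h.unity_mem

theorem exists_euler_lift (h : IsTangentImmersion M V φ) : ∃ ξ : (Fin n → 𝕜) → (Fin n → 𝕜), ContDiffOn 𝕜 ∞ ξ V ∧
    ∀ τ ∈ V, fderiv 𝕜 φ τ (ξ τ) = M.euler (φ τ) := by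
  refine exists_lift_of_mem_range h.isOpen h.contDiffOn h.injective_fderiv ?_ h.euler_mem
  have : M.euler = fun t => mulVecCLM M.q t + M.r := funext fun t => affineField_eq _ _ _
  rw [this]
  exact ((mulVecCLM M.q).contDiff.comp_contDiffOn h.contDiffOn).add contDiffOn_const

theorem fderiv_euler_comp (h : IsTangentImmersion M V φ) (hτ : τ ∈ V) (u : Fin n → 𝕜) :
    fderiv 𝕜 (fun σ => M.euler (φ σ)) τ u = mulVecCLM M.q (fderiv 𝕜 φ τ u) := by
  have h1 := (hasFDerivAt_affineField M.q M.r (φ τ)).comp τ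
    (h.contDiffOn.differentiableAt_of_isOpen h.isOpen hτ).hasFDerivAt
  have h2 : fderiv 𝕜 (fun σ => M.euler (φ σ)) τ = _ := h1.fderiv
  rw [h2]
  rfl

/-- The structure tensor of `M` vanishes on a normal and two tangent vectors. -/
theorem third_second_fderiv (h : IsTangentImmersion M V φ)
    (hn : HasNormalSecondDeriv M V φ) (hτ : τ ∈ V) (u v a b : Fin n → 𝕜) :
    M.third (φ τ) (fderiv 𝕜 φ τ a) (fderiv 𝕜 φ τ b) (fderiv 𝕜 (fderiv 𝕜 φ) τ u v) = 0 := by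
  -- The value is `⟨a ∘ b, D²φ⟩`, with the product tangent and `D²φ` normal.
  obtain ⟨w, hw⟩ := h.mul_mem τ hτ a b
  rw [← FrobeniusManifold.metric_mul (h.mapsTo hτ), ← hw, M.metric_comm, hn τ hτ]

/-- The tangential part of the derivative of `Dφ e = 𝕀` is `Dφ (∂e)`, while the right-hand side is
constant in `M`. -/
theorem fderiv_unity_lift (h : IsTangentImmersion M V φ)
    (hn : HasNormalSecondDeriv M V φ) {e : (Fin n → 𝕜) → (Fin n → 𝕜)} (he : ContDiffOn 𝕜 ∞ e V)
    (he' : ∀ τ ∈ V, fderiv 𝕜 φ τ (e τ) = M.unity) (hτ : τ ∈ V) : fderiv 𝕜 e τ = 0 := by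
  ext1 u
  refine h.eq_zero_of_metric hτ fun b => ?_
  have h1 := h.fderiv_lift he he' hτ u
  have h2 : fderiv 𝕜 (fun _ : Fin n → 𝕜 => M.unity) τ u = 0 := by simp
  have h3 := congrArg (fun x => M.metric x (fderiv 𝕜 φ τ b)) (h2.symm.trans h1)
  simp only [M.metric_add_left, hn τ hτ, zero_add] at h3
  rw [← h3]
  simp [M.metric_eq_bilinCLM]

/-- The bracket of the unity and the Euler field is tangent to `φ`. -/
theorem mulVecCLM_unity (h : IsTangentImmersion M V φ)
    (hn : HasNormalSecondDeriv M V φ) {e ξ : (Fin n → 𝕜) → (Fin n → 𝕜)} (he : ContDiffOn 𝕜 ∞ e V)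
    (he' : ∀ τ ∈ V, fderiv 𝕜 φ τ (e τ) = M.unity) (hξ : ContDiffOn 𝕜 ∞ ξ V)
    (hξ' : ∀ τ ∈ V, fderiv 𝕜 φ τ (ξ τ) = M.euler (φ τ)) (hτ : τ ∈ V) :
    mulVecCLM M.q M.unity = fderiv 𝕜 φ τ (fderiv 𝕜 ξ τ (e τ)) := by
  have h1 := h.fderiv_lift he he' hτ (ξ τ)
  rw [h.fderiv_unity_lift hn he he' hτ] at h1
  have h2 := h.fderiv_lift hξ hξ' hτ (e τ)
  rw [h.fderiv_euler_comp hτ, he' τ hτ, h.contDiffOn.fderiv_fderiv_symm h.isOpen hτ] at h2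
  -- `Dφ e = 𝕀` with `e` locally constant forces the full second derivative in the direction `e` to
  -- vanish, not only its tangential part.
  have h3 : fderiv 𝕜 (fderiv 𝕜 φ) τ (ξ τ) (e τ) = 0 := by simpa using h1.symm
  rw [h2, h3, zero_add]

/-- Differentiating `Dφ ξ = E ∘ φ` and dropping the normal term: the linear part of `E` agrees with
that of `ξ` up to normal vectors. -/
theorem metric_mulVecCLM (h : IsTangentImmersion M V φ)
    (hn : HasNormalSecondDeriv M V φ) {ξ : (Fin n → 𝕜) → (Fin n → 𝕜)} (hξ : ContDiffOn 𝕜 ∞ ξ V)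
    (hξ' : ∀ τ ∈ V, fderiv 𝕜 φ τ (ξ τ) = M.euler (φ τ)) (hτ : τ ∈ V) (u v : Fin n → 𝕜) :
    M.metric (mulVecCLM M.q (fderiv 𝕜 φ τ u)) (fderiv 𝕜 φ τ v) =
      M.metric (fderiv 𝕜 φ τ (fderiv 𝕜 ξ τ u)) (fderiv 𝕜 φ τ v) := by
  rw [← h.fderiv_euler_comp hτ, h.fderiv_lift hξ hξ' hτ, M.metric_add_left, hn τ hτ, zero_add]

/-- In flat coordinates the Euler field has vanishing second derivative. -/
theorem fderiv_fderiv_euler_lift (h : IsTangentImmersion M V φ)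
    (hn : HasNormalSecondDeriv M V φ) {ξ : (Fin n → 𝕜) → (Fin n → 𝕜)} (hξ : ContDiffOn 𝕜 ∞ ξ V)
    (hξ' : ∀ τ ∈ V, fderiv 𝕜 φ τ (ξ τ) = M.euler (φ τ)) (hτ : τ ∈ V) (u v : Fin n → 𝕜) :
    fderiv 𝕜 (fderiv 𝕜 ξ) τ u v = 0 := by
  obtain ⟨e, he, he'⟩ := h.exists_unity_lift
  set Q := mulVecCLM M.q with hQ
  set η := bilinCLM M.η with hη
  have hηM : ∀ a b, η a b = M.metric a b := fun a b => (M.metric_eq_bilinCLM a b).symm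
  -- `S` is the Lie derivative of the metric of `M` along `E`, a constant form.
  set S : (Fin m → 𝕜) →L[𝕜] (Fin m → 𝕜) →L[𝕜] 𝕜 := η.comp Q + (η.comp Q).flip with hS
  have hSapp : ∀ a b, S a b = M.metric (Q a) b + M.metric a (Q b) := fun a b => by
    rw [M.metric_comm a]
    simp [hS, hηM]
  have hSM : ∀ t ∈ M.region, ∀ a b, S a b = M.dF * M.metric a b - M.third t (Q M.unity) a b := by
    intro t ht a b
    rw [hSapp, ← FrobeniusManifold.third_euler_unity ht]
    ring
  -- This uses that `[𝕀, E]` is tangent: the `c`-term of `hSM` then has two tangent arguments and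
  -- one normal one.
  have hSnormal : ∀ σ ∈ V, ∀ a b d,
      S (fderiv 𝕜 φ σ d) (fderiv 𝕜 (fderiv 𝕜 φ) σ a b) = 0 := by
    intro σ hσ a b d
    rw [hSM (φ σ) (h.mapsTo hσ), hQ, h.mulVecCLM_unity hn he he' hξ hξ' hσ,
      h.third_second_fderiv hn hσ, M.metric_comm, hn σ hσ]
    simp
  have hSsymm : ∀ a b, S a b = S b a := fun a b => by
    rw [hSapp, hSapp, M.metric_comm (Q a), M.metric_comm a, add_comm]
  have hd : ∀ a, DifferentiableAt 𝕜 (fun σ => fderiv 𝕜 φ σ a) τ := fun a =>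
    (h.contDiffOn.dirDeriv h.isOpen a).differentiableAt_of_isOpen h.isOpen hτ
  have hdd : ∀ w a, fderiv 𝕜 (fun σ => fderiv 𝕜 φ σ a) τ w = fderiv 𝕜 (fderiv 𝕜 φ) τ w a :=
    fun w a => h.contDiffOn.dirDeriv_dirDeriv h.isOpen hτ w a
  have hξd : ∀ a, ContDiffOn 𝕜 ∞ (fun σ => fderiv 𝕜 φ σ (fderiv 𝕜 ξ σ a)) V := fun a =>
    (h.contDiffOn.fderiv_infty h.isOpen).clm_apply (hξ.dirDeriv h.isOpen a)
  have hξdd : ∀ w a, fderiv 𝕜 (fun σ => fderiv 𝕜 φ σ (fderiv 𝕜 ξ σ a)) τ w =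
      fderiv 𝕜 (fderiv 𝕜 φ) τ w (fderiv 𝕜 ξ τ a) +
        fderiv 𝕜 φ τ (fderiv 𝕜 (fderiv 𝕜 ξ) τ w a) := by
    intro w a
    have h1 := h.fderiv_lift (w := fun σ => fderiv 𝕜 φ σ (fderiv 𝕜 ξ σ a))
      (hξ.dirDeriv h.isOpen a) (fun _ _ => rfl) hτ w
    have h2 := hξ.dirDeriv_dirDeriv h.isOpen hτ w a
    rw [_root_.dirDeriv] at h2
    rwa [h2] at h1
  set A : (Fin n → 𝕜) → (Fin n → 𝕜) → (Fin n → 𝕜) → 𝕜 := fun w a b =>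
    M.metric (fderiv 𝕜 φ τ (fderiv 𝕜 (fderiv 𝕜 ξ) τ w a)) (fderiv 𝕜 φ τ b) with hA
  have hAsymm : ∀ w a b, A w a b = A a w b := fun w a b => by
    simp only [hA]
    rw [hξ.fderiv_fderiv_symm h.isOpen hτ]
  -- Differentiate the pullback of `S`, written on one side with `S` itself and on the other with
  -- the derivative of `ξ`. The first side gives zero by `hSnormal`; on the second, normality of
  -- `D²φ` leaves only second derivatives of `ξ`.
  have hAanti : ∀ w a b, A w a b + A w b a = 0 := by
    intro w a b
    have e1 : EqOn (fun σ => S (fderiv 𝕜 φ σ a) (fderiv 𝕜 φ σ b))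
        (fun σ => η (fderiv 𝕜 φ σ (fderiv 𝕜 ξ σ a)) (fderiv 𝕜 φ σ b) +
          η (fderiv 𝕜 φ σ (fderiv 𝕜 ξ σ b)) (fderiv 𝕜 φ σ a)) V := by
      intro σ hσ
      simp only [hηM]
      rw [hSapp, M.metric_comm (fderiv 𝕜 φ σ a), h.metric_mulVecCLM hn hξ hξ' hσ,
        h.metric_mulVecCLM hn hξ hξ' hσ]
    have e2 := congrArg (fun T => T w) (fderiv_eqOn (𝕜 := 𝕜) h.isOpen e1 hτ)
    have hb : ∀ a b, DifferentiableAt 𝕜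
        (fun σ => η (fderiv 𝕜 φ σ (fderiv 𝕜 ξ σ a)) (fderiv 𝕜 φ σ b)) τ := fun a b =>
      ((contDiffOn_const.clm_apply (hξd a)).clm_apply
        (h.contDiffOn.dirDeriv h.isOpen b)).differentiableAt_of_isOpen h.isOpen hτ
    rw [fderiv_fun_add (hb a b) (hb b a), _root_.add_apply,
      fderiv_bilinear_apply S (hd a) (hd b),
      fderiv_bilinear_apply η ((hξd a).differentiableAt_of_isOpen h.isOpen hτ) (hd b),
      fderiv_bilinear_apply η ((hξd b).differentiableAt_of_isOpen h.isOpen hτ) (hd a)] at e2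
    simp only [hdd, hξdd] at e2
    rw [hSsymm, hSnormal τ hτ, hSnormal τ hτ] at e2
    simp only [hηM, M.metric_add_left, hn τ hτ] at e2
    rw [M.metric_comm (fderiv 𝕜 φ τ (fderiv 𝕜 ξ τ a)), hn τ hτ,
      M.metric_comm (fderiv 𝕜 φ τ (fderiv 𝕜 ξ τ b)), hn τ hτ] at e2
    simpa [hA] using e2.symm
  refine h.eq_zero_of_metric hτ fun b => ?_
  -- A trilinear form symmetric in the first two and antisymmetric in the last two arguments is
  -- zero.
  have h1 := hAanti u v b
  have h2 := hAanti b v u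
  have h3 := hAanti v u b
  rw [hAsymm b v u] at h2
  rw [hAsymm v u b, hAsymm v b u] at h3
  rw [hAsymm u b v] at h1
  have h4 := hAsymm v b u
  change A u v b = 0
  have h5 : (2 : 𝕜) * A u v b = 0 := by linear_combination h1 + h3 - h2 + h4
  simpa using h5

end IsTangentImmersion

end InducedGeometry

/-! ### Christoffel symbols, curvature as integrability, and the Gauss formula. -/

section LeviCivita

open Set

variable {𝕜 : Type*} [RCLike 𝕜]

section

variable {E W : Type*} [NormedAddCommGroup E] [NormedSpace 𝕜 E] [NormedAddCommGroup W]
  [NormedSpace 𝕜 W] {G : Type*} [NormedAddCommGroup G] [NormedSpace 𝕜 G]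

theorem fderiv_apply₂ {T : E → G →L[𝕜] G →L[𝕜] W} {x : E} (hT : DifferentiableAt 𝕜 T x) (u : E)
    (a b : G) : fderiv 𝕜 T x u a b = fderiv 𝕜 (fun y => T y a b) x u := by
  have h := (hT.hasFDerivAt.clm_apply (hasFDerivAt_const a x)).clm_apply (hasFDerivAt_const b x)
  have h2 : fderiv 𝕜 (fun y => T y a b) x = _ := h.fderiv
  rw [h2]
  simp

theorem fderiv_apply₃ {T : E → G →L[𝕜] G →L[𝕜] G →L[𝕜] W} {x : E} (hT : DifferentiableAt 𝕜 T x)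
    (u : E) (a b d : G) : fderiv 𝕜 T x u a b d = fderiv 𝕜 (fun y => T y a b d) x u := by
  have h := ((hT.hasFDerivAt.clm_apply (hasFDerivAt_const a x)).clm_apply
    (hasFDerivAt_const b x)).clm_apply (hasFDerivAt_const d x)
  have h2 : fderiv 𝕜 (fun y => T y a b d) x = _ := h.fderiv
  rw [h2]
  simp

end

variable {m n : ℕ}

theorem trilinear_eq_zero {W : Type*} [NormedAddCommGroup W] [NormedSpace 𝕜 W]
    {T : (Fin n → 𝕜) →L[𝕜] (Fin n → 𝕜) →L[𝕜] (Fin n → 𝕜) →L[𝕜] W}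
    (hT : ∀ i j k, T (Pi.single i 1) (Pi.single j 1) (Pi.single k 1) = 0) (u v w : Fin n → 𝕜) :
    T u v w = 0 := by
  have h1 : ∀ i j, T (Pi.single i 1) (Pi.single j 1) w = 0 := fun i j => by
    rw [clm_apply_eq_sum (T (Pi.single i 1) (Pi.single j 1)) w]
    simp [hT]
  have h2 : ∀ i, T (Pi.single i 1) v w = 0 := fun i => by
    rw [clm_apply_eq_sum (T (Pi.single i 1)) v]
    simp [h1, _root_.sum_apply]
  rw [clm_apply_eq_sum T u]
  simp [h2, _root_.sum_apply]

theorem contDiffOn_det {U : Set (Fin n → 𝕜)} {k : ℕ} {g : (Fin n → 𝕜) → Matrix (Fin k) (Fin k) 𝕜}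
    (hg : ∀ i j, ContDiffOn 𝕜 ∞ (fun τ => g τ i j) U) :
    ContDiffOn 𝕜 ∞ (fun τ => (g τ).det) U := by
  simp only [Matrix.det_apply']
  exact ContDiffOn.sum fun σ _ => contDiffOn_const.mul (contDiffOn_prod fun i _ => hg _ _)

/-- Cramer's rule: the entries are quotients of determinants, with nonvanishing denominator. -/
theorem contDiffOn_matrix_inv {U : Set (Fin n → 𝕜)} {k : ℕ}
    {g : (Fin n → 𝕜) → Matrix (Fin k) (Fin k) 𝕜}
    (hg : ∀ i j, ContDiffOn 𝕜 ∞ (fun τ => g τ i j) U) (hdet : ∀ τ ∈ U, IsUnit (g τ).det)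
    (i j : Fin k) : ContDiffOn 𝕜 ∞ (fun τ => (g τ)⁻¹ i j) U := by
  have h : (fun τ => (g τ)⁻¹ i j) = fun τ => (g τ).det⁻¹ *
      ((g τ).updateRow j (Pi.single i 1)).det := by
    ext τ
    rw [Matrix.inv_def, Matrix.smul_apply, Matrix.adjugate_apply, Ring.inverse_eq_inv', smul_eq_mul]
  rw [h]
  refine ((contDiffOn_det hg).inv fun τ hτ => (hdet τ hτ).ne_zero).mul (contDiffOn_det fun a b => ?_)
  by_cases hab : a = j
  · subst hab
    simp only [Matrix.updateRow_self]
    exact contDiffOn_const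
  · simp only [Matrix.updateRow_ne hab]
    exact hg a b

theorem contDiffOn_christoffel {U : Set (Fin n → 𝕜)} (hU : IsOpen U)
    {g : (Fin n → 𝕜) → Matrix (Fin n) (Fin n) 𝕜}
    (hg : ∀ i j, ContDiffOn 𝕜 ∞ (fun τ => g τ i j) U) (hdet : ∀ τ ∈ U, IsUnit (g τ).det)
    (γ α β : Fin n) : ContDiffOn 𝕜 ∞ (christoffel g γ α β) U := by
  have hd : ∀ a i j, ContDiffOn 𝕜 ∞ (coordDeriv a fun σ => g σ i j) U := fun a i j =>
    (hg i j).dirDeriv hU _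
  exact contDiffOn_const.mul (ContDiffOn.sum fun δ _ => (contDiffOn_matrix_inv hg hdet γ δ).mul
    (((hd _ _ _).add (hd _ _ _)).sub (hd _ _ _)))

theorem christoffel_symm {g : (Fin n → 𝕜) → Matrix (Fin n) (Fin n) 𝕜}
    (hg : ∀ τ i j, g τ i j = g τ j i) (γ α β : Fin n) (τ : Fin n → 𝕜) :
    christoffel g γ α β τ = christoffel g γ β α τ := by
  simp only [christoffel]
  congr 1
  refine Finset.sum_congr rfl fun δ _ => ?_
  rw [show (fun σ => g σ α β) = fun σ => g σ β α from funext fun σ => hg σ α β]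
  ring

/-- Christoffel symbols as a continuous bilinear map. -/
noncomputable def christoffelCLM (g : (Fin n → 𝕜) → Matrix (Fin n) (Fin n) 𝕜) (τ : Fin n → 𝕜) :
    (Fin n → 𝕜) →L[𝕜] (Fin n → 𝕜) →L[𝕜] (Fin n → 𝕜) :=
  ∑ γ, ∑ α, ∑ β, christoffel g γ α β τ •
    (ContinuousLinearMap.proj α : (Fin n → 𝕜) →L[𝕜] 𝕜).smulRight
      ((ContinuousLinearMap.proj β : (Fin n → 𝕜) →L[𝕜] 𝕜).smulRight
        (Pi.single γ 1 : Fin n → 𝕜))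

theorem christoffelCLM_apply (g : (Fin n → 𝕜) → Matrix (Fin n) (Fin n) 𝕜) (τ u v : Fin n → 𝕜)
    (γ : Fin n) :
    christoffelCLM g τ u v γ = ∑ α, ∑ β, christoffel g γ α β τ * (u α * v β) := by
  simp [christoffelCLM, Finset.sum_apply, Pi.single_apply]

theorem christoffelCLM_single (g : (Fin n → 𝕜) → Matrix (Fin n) (Fin n) 𝕜) (τ : Fin n → 𝕜)
    (α β γ : Fin n) : christoffelCLM g τ (Pi.single α 1) (Pi.single β 1) γ =
      christoffel g γ α β τ := by
  rw [christoffelCLM_apply]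
  simp [Pi.single_apply]

theorem christoffelCLM_symm {g : (Fin n → 𝕜) → Matrix (Fin n) (Fin n) 𝕜}
    (hg : ∀ τ i j, g τ i j = g τ j i) (τ u v : Fin n → 𝕜) :
    christoffelCLM g τ u v = christoffelCLM g τ v u := by
  ext γ
  rw [christoffelCLM_apply, christoffelCLM_apply, Finset.sum_comm]
  refine Finset.sum_congr rfl fun i _ => Finset.sum_congr rfl fun j _ => ?_
  rw [christoffel_symm hg]
  ring

theorem contDiffOn_christoffelCLM {U : Set (Fin n → 𝕜)} (hU : IsOpen U)
    {g : (Fin n → 𝕜) → Matrix (Fin n) (Fin n) 𝕜}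
    (hg : ∀ i j, ContDiffOn 𝕜 ∞ (fun τ => g τ i j) U) (hdet : ∀ τ ∈ U, IsUnit (g τ).det) :
    ContDiffOn 𝕜 ∞ (christoffelCLM g) U :=
  ContDiffOn.sum fun γ _ => ContDiffOn.sum fun α _ => ContDiffOn.sum fun β _ =>
    (contDiffOn_christoffel hU hg hdet γ α β).smul contDiffOn_const

/-- Vanishing of the Riemann tensor is the integrability condition for flat coordinates. -/
theorem christoffelCLM_integrable {U : Set (Fin n → 𝕜)} (hU : IsOpen U)
    {g : (Fin n → 𝕜) → Matrix (Fin n) (Fin n) 𝕜}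
    (hg : ∀ i j, ContDiffOn 𝕜 ∞ (fun τ => g τ i j) U) (hdet : ∀ τ ∈ U, IsUnit (g τ).det)
    {τ : Fin n → 𝕜} (hτ : τ ∈ U) (hR : ∀ δ γ α β, riemannCurvature g δ γ α β τ = 0)
    (u v w : Fin n → 𝕜) :
    fderiv 𝕜 (christoffelCLM g) τ v u w + christoffelCLM g τ v (christoffelCLM g τ u w) =
      fderiv 𝕜 (christoffelCLM g) τ u v w + christoffelCLM g τ u (christoffelCLM g τ v w) := by
  set Γ := christoffelCLM g with hΓ
  have hΓd := (contDiffOn_christoffelCLM hU hg hdet).differentiableAt_of_isOpen hU hτ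
  set Q : (Fin n → 𝕜) →L[𝕜] (Fin n → 𝕜) →L[𝕜] (Fin n → 𝕜) →L[𝕜] (Fin n → 𝕜) :=
    fderiv 𝕜 Γ τ + (ContinuousLinearMap.compL 𝕜 (Fin n → 𝕜) (Fin n → 𝕜) (Fin n → 𝕜)).bilinearComp
      (Γ τ) (Γ τ) with hQ
  have hQapp : ∀ v u w, Q v u w = fderiv 𝕜 Γ τ v u w + Γ τ v (Γ τ u w) := fun v u w => rfl
  have hfd : ∀ α β γ δ : Fin n, fderiv 𝕜 Γ τ (Pi.single α 1) (Pi.single β 1) (Pi.single γ 1) δ =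
      coordDeriv α (christoffel g δ β γ) τ := by
    intro α β γ δ
    rw [fderiv_apply₂ hΓd]
    have h1 : DifferentiableAt 𝕜 (fun σ => Γ σ (Pi.single β 1) (Pi.single γ 1)) τ :=
      (hΓd.clm_apply (differentiableAt_const _)).clm_apply (differentiableAt_const _)
    have h2 := ((ContinuousLinearMap.proj (R := 𝕜) (φ := fun _ : Fin n => 𝕜) δ).hasFDerivAt.comp τ
      h1.hasFDerivAt).fderiv
    have h3 : (ContinuousLinearMap.proj (R := 𝕜) (φ := fun _ : Fin n => 𝕜) δ) ∘
        (fun σ => Γ σ (Pi.single β 1) (Pi.single γ 1)) = christoffel g δ β γ :=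
      funext fun σ => christoffelCLM_single g σ β γ δ
    rw [h3] at h2
    rw [coordDeriv, h2]
    rfl
  have hcomp : ∀ α β γ δ : Fin n, Γ τ (Pi.single α 1) (Γ τ (Pi.single β 1) (Pi.single γ 1)) δ =
      ∑ ε, christoffel g δ α ε τ * christoffel g ε β γ τ := by
    intro α β γ δ
    rw [clm_apply_eq_sum (Γ τ (Pi.single α 1))]
    simp [Finset.sum_apply, hΓ, christoffelCLM_single, mul_comm]
  -- On basis vectors the antisymmetrization of `Q` has the components of the Riemann tensor.
  have key := trilinear_eq_zero (T := Q - Q.flip) (fun α β γ => by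
    ext δ
    have := hR δ γ α β
    rw [riemannCurvature, Finset.sum_sub_distrib] at this
    simp only [_root_.sub_apply, ContinuousLinearMap.flip_apply, Pi.sub_apply, hQapp,
      Pi.add_apply, hfd, hcomp, Pi.zero_apply]
    linear_combination this) v u w
  simp only [_root_.sub_apply, ContinuousLinearMap.flip_apply, hQapp] at key
  exact sub_eq_zero.1 key

variable [NeZero m] {M : FrobeniusManifold 𝕜 m} {V : Set (Fin n → 𝕜)}
  {φ : (Fin n → 𝕜) → (Fin m → 𝕜)}

theorem inducedMetric_symm (τ : Fin n → 𝕜) (i j : Fin n) :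
    inducedMetric M φ τ i j = inducedMetric M φ τ j i := M.metric_comm _ _

theorem contDiffOn_inducedMetric (hV : IsOpen V) (hφ : ContDiffOn 𝕜 ∞ φ V) (i j : Fin n) :
    ContDiffOn 𝕜 ∞ (fun τ => inducedMetric M φ τ i j) V := by
  simp only [inducedMetric, M.metric_eq_bilinCLM]
  exact (contDiffOn_const.clm_apply (hφ.dirDeriv hV _)).clm_apply (hφ.dirDeriv hV _)

/-- The Gauss formula: the tangential part of the second derivative of `φ` is given by the
Christoffel symbols. -/
theorem metric_second_fderiv_eq_christoffel (hV : IsOpen V) (hφ : ContDiffOn 𝕜 ∞ φ V)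
    {τ : Fin n → 𝕜} (hτ : τ ∈ V) (hdet : IsUnit (inducedMetric M φ τ).det) (u v w : Fin n → 𝕜) :
    M.metric (fderiv 𝕜 (fderiv 𝕜 φ) τ u v) (fderiv 𝕜 φ τ w) =
      M.metric (fderiv 𝕜 φ τ (christoffelCLM (inducedMetric M φ) τ u v)) (fderiv 𝕜 φ τ w) := by
  set g := inducedMetric M φ with hg
  set D := fderiv 𝕜 φ τ with hD
  set X : (Fin n → 𝕜) →L[𝕜] (Fin n → 𝕜) →L[𝕜] (Fin m → 𝕜) := fderiv 𝕜 (fderiv 𝕜 φ) τ -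
    (ContinuousLinearMap.compL 𝕜 (Fin n → 𝕜) (Fin n → 𝕜) (Fin m → 𝕜) D).comp
      (christoffelCLM g τ) with hX
  have hXapp : ∀ u v, X u v = fderiv 𝕜 (fderiv 𝕜 φ) τ u v - D (christoffelCLM g τ u v) :=
    fun u v => rfl
  set A : (Fin m → 𝕜) →L[𝕜] (Fin n → 𝕜) →L[𝕜] 𝕜 :=
    ((ContinuousLinearMap.compL 𝕜 (Fin n → 𝕜) (Fin m → 𝕜) 𝕜).flip D).comp (bilinCLM M.η) with hA
  have hAapp : ∀ a w, A a w = M.metric a (D w) := fun a w => by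
    rw [M.metric_eq_bilinCLM]; rfl
  set T : (Fin n → 𝕜) →L[𝕜] (Fin n → 𝕜) →L[𝕜] (Fin n → 𝕜) →L[𝕜] 𝕜 :=
    (ContinuousLinearMap.compL 𝕜 (Fin n → 𝕜) (Fin m → 𝕜) ((Fin n → 𝕜) →L[𝕜] 𝕜) A).comp X with hT
  have hTapp : ∀ u v w, T u v w = M.metric (X u v) (D w) := fun u v w => hAapp _ _
  -- Both sides are trilinear, and on basis vectors the Koszul formula is the definition of the
  -- Christoffel symbols with the index lowered.
  have key := trilinear_eq_zero (T := T) (fun α β δ => by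
    rw [hTapp, hXapp, M.metric_sub_left, metric_second_fderiv hV hφ hτ, sub_eq_zero]
    rw [clm_apply_eq_sum D]
    have e1 : ∀ i j, (fun σ => M.metric (fderiv 𝕜 φ σ (Pi.single i 1))
        (fderiv 𝕜 φ σ (Pi.single j 1))) = fun σ => g σ i j := fun i j => rfl
    simp only [christoffelCLM_single, e1]
    have e2 : M.metric (∑ γ, christoffel g γ α β τ • D (Pi.single γ 1)) (D (Pi.single δ 1)) =
        ∑ γ, g τ δ γ * christoffel g γ α β τ := by
      simp only [M.metric_eq_bilinCLM, map_sum, map_smul, _root_.sum_apply, _root_.smul_apply,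
        smul_eq_mul]
      refine Finset.sum_congr rfl fun γ _ => ?_
      rw [← M.metric_eq_bilinCLM, M.metric_comm, mul_comm]
      rfl
    rw [e2]
    set S : Fin n → 𝕜 := fun δ => coordDeriv α (fun σ => g σ δ β) τ +
      coordDeriv β (fun σ => g σ δ α) τ - coordDeriv δ (fun σ => g σ α β) τ with hS
    have e3 : ∀ γ, christoffel g γ α β τ = (1 / 2) * Matrix.mulVec (g τ)⁻¹ S γ := fun γ => rfl
    have e4 : ∑ γ, g τ δ γ * ((1 / 2) * Matrix.mulVec (g τ)⁻¹ S γ) =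
        (1 / 2) * Matrix.mulVec (g τ) (Matrix.mulVec (g τ)⁻¹ S) δ := by
      rw [Matrix.mulVec, dotProduct, Finset.mul_sum]
      refine Finset.sum_congr rfl fun γ _ => ?_
      ring
    simp only [e3]
    rw [e4, Matrix.mulVec_mulVec, Matrix.mul_nonsing_inv _ hdet, Matrix.one_mulVec]
    rfl) u v w
  rw [hTapp, hXapp, M.metric_sub_left] at key
  exact sub_eq_zero.1 key

end LeviCivita

/-! ### Affine Euler field and adapted flat coordinates. -/

section FlatSubmanifolds

open Set Metric

variable {𝕜 : Type*} [RCLike 𝕜] {m n : ℕ} [NeZero m] {M : FrobeniusManifold 𝕜 m}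
  {V : Set (Fin n → 𝕜)} {φ : (Fin n → 𝕜) → (Fin m → 𝕜)}

theorem FrobeniusManifold.unity_ne_zero (M : FrobeniusManifold 𝕜 m) : M.unity ≠ 0 := by
  intro h
  simpa [FrobeniusManifold.unity] using congrFun h 0

namespace IsTangentImmersion

theorem exists_euler_affine (h : IsTangentImmersion M V φ) (hn : HasNormalSecondDeriv M V φ)
    (hV : IsPreconnected V) : ∃ (q : Matrix (Fin n) (Fin n) 𝕜) (r : Fin n → 𝕜),
      ∀ τ ∈ V, fderiv 𝕜 φ τ (affineField q r τ) = M.euler (φ τ) := by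
  obtain ⟨ξ, hξ, hξ'⟩ := h.exists_euler_lift
  obtain ⟨A, r, hA⟩ := exists_affine_of_fderiv_fderiv_eq_zero h.isOpen hV hξ
    fun τ hτ u v => h.fderiv_fderiv_euler_lift hn hξ hξ' hτ u v
  obtain ⟨q, hq⟩ := exists_mulVecCLM_eq A
  refine ⟨q, r, fun τ hτ => ?_⟩
  rw [affineField_eq, hq, ← (hA τ hτ).1, hξ' τ hτ]

/-- Around every point of a flat submanifold there are flat coordinates in which the unity is the
first coordinate field. -/
theorem exists_flat_reparam [NeZero n] (h : IsTangentImmersion M V φ)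
    (hR : ∀ τ ∈ V, ∀ δ γ α β, riemannCurvature (inducedMetric M φ) δ γ α β τ = 0)
    {c : Fin n → 𝕜} (hc : c ∈ V) :
    ∃ (p : Fin n → 𝕜) (ρ : ℝ) (z : (Fin n → 𝕜) → (Fin n → 𝕜)), 0 < ρ ∧
      ContDiffOn 𝕜 ∞ z (ball p ρ) ∧ MapsTo z (ball p ρ) V ∧ InjOn z (ball p ρ) ∧
      (∀ x ∈ ball p ρ, Function.Injective (fderiv 𝕜 z x)) ∧
      (∀ O ⊆ ball p ρ, IsOpen O → IsOpen (z '' O)) ∧ z p = c ∧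
      HasNormalSecondDeriv M (ball p ρ) (φ ∘ z) ∧
      fderiv 𝕜 (φ ∘ z) p (Pi.single 0 1) = M.unity := by
  obtain ⟨e₀, he₀⟩ := h.unity_mem c hc
  have he₀' : e₀ ≠ 0 := by
    rintro rfl
    exact M.unity_ne_zero (by rw [← he₀, map_zero])
  have hs : (Pi.single 0 1 : Fin n → 𝕜) ≠ 0 := fun h0 => by simpa using congrFun h0 0
  -- `L` takes the unity at `c` to the first basis vector; prescribing `Dy = L` at `c` makes the
  -- unity the first coordinate vector there.
  obtain ⟨L, hL⟩ := SeparatingDual.exists_continuousLinearEquiv_apply_eq (R := 𝕜) he₀' hs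
  have hgs := contDiffOn_inducedMetric (M := M) h.isOpen h.contDiffOn
  obtain ⟨r, hr, hrV, y, hy, hyL, hyΓ⟩ := exists_flat_coordinates h.isOpen hc
    (contDiffOn_christoffelCLM h.isOpen hgs h.nondegenerate)
    (fun τ _ => christoffelCLM_symm inducedMetric_symm τ)
    (fun τ hτ => christoffelCLM_integrable h.isOpen hgs h.nondegenerate hτ (hR τ hτ))
    (L : (Fin n → 𝕜) →L[𝕜] (Fin n → 𝕜))
  obtain ⟨ρ, hρ, z, hz, hzm, hzc, hyz, hyinj, hzopen⟩ :=
    exists_local_inverse isOpen_ball hy (mem_ball_self hr) L hyL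
  have hB : IsOpen (ball (y c) ρ) := isOpen_ball
  have hyd : ∀ x ∈ ball (y c) ρ, ∀ u, fderiv 𝕜 y (z x) (fderiv 𝕜 z x u) = u := by
    intro x hx u
    have h1 := (hy.differentiableAt_of_isOpen isOpen_ball (hzm hx)).hasFDerivAt.comp x
      (hz.differentiableAt_of_isOpen hB hx).hasFDerivAt
    have h2 : EqOn (y ∘ z) id (ball (y c) ρ) := fun p hp => hyz p hp
    have h3 := fderiv_eqOn (𝕜 := 𝕜) hB h2 hx
    rw [h1.fderiv, fderiv_id] at h3
    exact congrArg (fun T => T u) h3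
  have hzV : MapsTo z (ball (y c) ρ) V := fun x hx => hrV (hzm hx)
  -- Obtained by differentiating `y ∘ z = id` twice. This `-Γ` cancels the tangential part of `D²φ`
  -- in the second derivative of `φ ∘ z`.
  have hz2 : ∀ x ∈ ball (y c) ρ, ∀ u v, fderiv 𝕜 (fderiv 𝕜 z) x u v =
      -christoffelCLM (inducedMetric M φ) (z x) (fderiv 𝕜 z x u) (fderiv 𝕜 z x v) := by
    intro x hx u v
    have h1 := fderiv_fderiv_comp hB isOpen_ball hz hy hzm hx u v
    have h2 : EqOn (y ∘ z) id (ball (y c) ρ) := fun p hp => hyz p hp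
    rw [fderiv_eqOn hB (fderiv_eqOn hB h2) hx, hyΓ _ (hzm hx), ← map_add] at h1
    have h3 : fderiv 𝕜 (fderiv 𝕜 (id : (Fin n → 𝕜) → (Fin n → 𝕜))) x u v = 0 := by
      rw [show fderiv 𝕜 (id : (Fin n → 𝕜) → (Fin n → 𝕜)) =
        fun _ => ContinuousLinearMap.id 𝕜 (Fin n → 𝕜) from funext fun x => fderiv_id]
      simp
    rw [h3] at h1
    have h4 := hyinj x hx (h1.symm.trans (map_zero _).symm)
    exact eq_neg_of_add_eq_zero_right h4
  have hcomp : ∀ x ∈ ball (y c) ρ, ∀ u,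
      fderiv 𝕜 (φ ∘ z) x u = fderiv 𝕜 φ (z x) (fderiv 𝕜 z x u) := by
    intro x hx u
    rw [fderiv_comp x (h.contDiffOn.differentiableAt_of_isOpen h.isOpen (hzV hx))
      (hz.differentiableAt_of_isOpen hB hx)]
    rfl
  refine ⟨y c, ρ, z, hρ, hz, hzV, fun a ha b hb hab => ?_, fun x hx a b hab => ?_, hzopen, hzc,
    fun x hx u v w => ?_, ?_⟩
  · rw [← hyz a ha, ← hyz b hb, hab]
  · rw [← hyd x hx a, ← hyd x hx b, hab]
  · rw [fderiv_fderiv_comp hB h.isOpen hz h.contDiffOn hzV hx, hcomp x hx, hz2 x hx, map_neg,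
      ← sub_eq_add_neg, M.metric_sub_left,
      metric_second_fderiv_eq_christoffel h.isOpen h.contDiffOn (hzV hx)
        (h.nondegenerate _ (hzV hx)), sub_self]
  · have hmem : y c ∈ ball (y c) ρ := mem_ball_self hρ
    rw [hcomp _ hmem, ← he₀, hzc]
    congr 1
    have h1 := hyd _ hmem (Pi.single 0 1)
    rw [hzc, hyL] at h1
    exact L.injective (h1.trans hL.symm)

end IsTangentImmersion

end FlatSubmanifolds

/-! ### Pullback of trilinear forms. -/

section TrilinearPullback

variable {𝕜 : Type*} [RCLike 𝕜] {m n : ℕ}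

/-- The pullback of a trilinear form along a linear map. -/
noncomputable def trilinearPullback (C : (Fin m → 𝕜) →L[𝕜] (Fin m → 𝕜) →L[𝕜] (Fin m → 𝕜) →L[𝕜] 𝕜)
    (D : (Fin n → 𝕜) →L[𝕜] (Fin m → 𝕜)) :
    (Fin n → 𝕜) →L[𝕜] (Fin n → 𝕜) →L[𝕜] (Fin n → 𝕜) →L[𝕜] 𝕜 :=
  (ContinuousLinearMap.compL 𝕜 (Fin n → 𝕜) ((Fin m → 𝕜) →L[𝕜] 𝕜) ((Fin n → 𝕜) →L[𝕜] 𝕜)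
    ((ContinuousLinearMap.compL 𝕜 (Fin n → 𝕜) (Fin m → 𝕜) 𝕜).flip D)).comp (C.bilinearComp D D)

end TrilinearPullback

/-! ### The pulled back structure tensor and the induced Frobenius manifold. -/

section PulledBackStructure

open Set Metric

variable {𝕜 : Type*} [RCLike 𝕜] {m n : ℕ} [NeZero m] {M : FrobeniusManifold 𝕜 m}
  {V : Set (Fin n → 𝕜)} {φ : (Fin n → 𝕜) → (Fin m → 𝕜)}

/-- The structure tensor of `M` pulled back along `φ`. -/
noncomputable def pulledThird (M : FrobeniusManifold 𝕜 m) (φ : (Fin n → 𝕜) → (Fin m → 𝕜))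
    (τ : Fin n → 𝕜) : (Fin n → 𝕜) →L[𝕜] (Fin n → 𝕜) →L[𝕜] (Fin n → 𝕜) →L[𝕜] 𝕜 :=
  trilinearPullback (M.third (φ τ)) (fderiv 𝕜 φ τ)

theorem pulledThird_apply (τ a b d : Fin n → 𝕜) : pulledThird M φ τ a b d =
    M.third (φ τ) (fderiv 𝕜 φ τ a) (fderiv 𝕜 φ τ b) (fderiv 𝕜 φ τ d) := rfl

namespace IsTangentImmersion

variable {τ : Fin n → 𝕜}

theorem contDiffOn_pulledThird (h : IsTangentImmersion M V φ) :
    ContDiffOn 𝕜 ∞ (pulledThird M φ) V := by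
  refine contDiffOn_clm_apply.2 fun a => contDiffOn_clm_apply.2 fun b =>
    contDiffOn_clm_apply.2 fun d => ?_
  simp only [pulledThird_apply]
  exact (((FrobeniusManifold.contDiffOn_third.comp h.contDiffOn h.mapsTo).clm_apply
    (h.contDiffOn.dirDeriv h.isOpen a)).clm_apply (h.contDiffOn.dirDeriv h.isOpen b)).clm_apply
      (h.contDiffOn.dirDeriv h.isOpen d)

theorem pulledThird_swap₁₂ (h : IsTangentImmersion M V φ) (hτ : τ ∈ V) (a b d) :
    pulledThird M φ τ a b d = pulledThird M φ τ b a d :=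
  FrobeniusManifold.third_swap₁₂ (h.mapsTo hτ) _ _ _

theorem pulledThird_swap₂₃ (h : IsTangentImmersion M V φ) (hτ : τ ∈ V) (a b d) :
    pulledThird M φ τ a b d = pulledThird M φ τ a d b :=
  FrobeniusManifold.third_swap₂₃ (h.mapsTo hτ) _ _ _

theorem third_second_fderiv_left (h : IsTangentImmersion M V φ) (hn : HasNormalSecondDeriv M V φ)
    (hτ : τ ∈ V) (u v a b) :
    M.third (φ τ) (fderiv 𝕜 (fderiv 𝕜 φ) τ u v) (fderiv 𝕜 φ τ a) (fderiv 𝕜 φ τ b) = 0 := by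
  rw [FrobeniusManifold.third_swap₁₂ (h.mapsTo hτ), FrobeniusManifold.third_swap₂₃ (h.mapsTo hτ)]
  exact h.third_second_fderiv hn hτ u v a b

theorem third_second_fderiv_middle (h : IsTangentImmersion M V φ)
    (hn : HasNormalSecondDeriv M V φ) (hτ : τ ∈ V) (u v a b) :
    M.third (φ τ) (fderiv 𝕜 φ τ a) (fderiv 𝕜 (fderiv 𝕜 φ) τ u v) (fderiv 𝕜 φ τ b) = 0 := by
  rw [FrobeniusManifold.third_swap₂₃ (h.mapsTo hτ)]
  exact h.third_second_fderiv hn hτ u v a b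

/-- In flat coordinates, the derivative of the pulled back structure tensor is the pullback of its
derivative. -/
theorem fderiv_pulledThird (h : IsTangentImmersion M V φ) (hn : HasNormalSecondDeriv M V φ)
    (hτ : τ ∈ V) (u a b d) : fderiv 𝕜 (pulledThird M φ) τ u a b d =
      fderiv 𝕜 M.third (φ τ) (fderiv 𝕜 φ τ u) (fderiv 𝕜 φ τ a) (fderiv 𝕜 φ τ b)
        (fderiv 𝕜 φ τ d) := by
  have hM := h.mapsTo hτ
  have hd : ∀ a, DifferentiableAt 𝕜 (fun σ => fderiv 𝕜 φ σ a) τ := fun a =>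
    (h.contDiffOn.dirDeriv h.isOpen a).differentiableAt_of_isOpen h.isOpen hτ
  have hdd : ∀ a, fderiv 𝕜 (fun σ => fderiv 𝕜 φ σ a) τ u = fderiv 𝕜 (fderiv 𝕜 φ) τ u a :=
    fun a => h.contDiffOn.dirDeriv_dirDeriv h.isOpen hτ u a
  rw [fderiv_apply₃ (h.contDiffOn_pulledThird.differentiableAt_of_isOpen h.isOpen hτ)]
  simp only [pulledThird_apply]
  rw [fderiv_trilinear_comp
    (FrobeniusManifold.contDiffOn_third.differentiableAt_of_isOpen M.isOpen_region hM)
    (h.contDiffOn.differentiableAt_of_isOpen h.isOpen hτ) (hd a) (hd b) (hd d), hdd, hdd, hdd,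
    h.third_second_fderiv_left hn hτ, h.third_second_fderiv_middle hn hτ,
    h.third_second_fderiv hn hτ]
  simp

/-- Quasihomogeneity of the pulled back structure tensor. -/
theorem fderiv_pulledThird_euler (h : IsTangentImmersion M V φ) (hn : HasNormalSecondDeriv M V φ)
    {q : Matrix (Fin n) (Fin n) 𝕜} {r : Fin n → 𝕜}
    (hq : ∀ τ ∈ V, fderiv 𝕜 φ τ (affineField q r τ) = M.euler (φ τ)) (hτ : τ ∈ V) (a b d) :
    fderiv 𝕜 (pulledThird M φ) τ (affineField q r τ) a b d +
      pulledThird M φ τ (mulVecCLM q a) b d + pulledThird M φ τ a (mulVecCLM q b) d +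
      pulledThird M φ τ a b (mulVecCLM q d) = M.dF * pulledThird M φ τ a b d := by
  have hM := h.mapsTo hτ
  have hξ : ContDiffOn 𝕜 ∞ (affineField q r) V := by
    rw [show affineField q r = fun t => mulVecCLM q t + r from funext (affineField_eq q r)]
    exact ((mulVecCLM q).contDiff.add contDiff_const).contDiffOn
  -- Splits the image of a tangent vector under the linear part of `E` into a normal term, killed by
  -- `c` against two tangent vectors, and a tangent term.
  have hQ : ∀ u, mulVecCLM M.q (fderiv 𝕜 φ τ u) =
      fderiv 𝕜 (fderiv 𝕜 φ) τ u (affineField q r τ) + fderiv 𝕜 φ τ (mulVecCLM q u) := by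
    intro u
    rw [← h.fderiv_euler_comp hτ, h.fderiv_lift hξ hq hτ, (hasFDerivAt_affineField q r τ).fderiv]
  have key := FrobeniusManifold.fderiv_third_euler hM (fderiv 𝕜 φ τ a) (fderiv 𝕜 φ τ b)
    (fderiv 𝕜 φ τ d)
  rw [hQ, hQ, hQ] at key
  simp only [map_add, _root_.add_apply] at key
  rw [h.third_second_fderiv_left hn hτ, h.third_second_fderiv_middle hn hτ,
    h.third_second_fderiv hn hτ, ← hq τ hτ, ← h.fderiv_pulledThird hn hτ] at key
  simp only [pulledThird_apply]
  linear_combination key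

/-- In flat coordinates on a connected domain the induced metric is constant. -/
theorem inducedMetric_eq (h : IsTangentImmersion M V φ) (hn : HasNormalSecondDeriv M V φ)
    (hV : IsPreconnected V) {c : Fin n → 𝕜} (hc : c ∈ V) (hτ : τ ∈ V) :
    inducedMetric M φ τ = inducedMetric M φ c := by
  ext i j
  refine h.isOpen.is_const_of_fderiv_eq_zero (𝕜 := 𝕜)
    (f := fun σ => inducedMetric M φ σ i j) hV
    ((contDiffOn_inducedMetric h.isOpen h.contDiffOn i j).differentiableOn (by simp))
    (fun σ hσ => ?_) hτ hc
  ext1 u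
  simp only [inducedMetric]
  rw [fderiv_metric_fderiv h.isOpen h.contDiffOn hσ, hn σ hσ, M.metric_comm, hn σ hσ]
  simp

/-- In flat coordinates on a connected domain the components of the unity are constant. -/
theorem fderiv_eq_unity (h : IsTangentImmersion M V φ) (hn : HasNormalSecondDeriv M V φ)
    (hV : IsPreconnected V) {c : Fin n → 𝕜} (hc : c ∈ V) {e₀ : Fin n → 𝕜}
    (he₀ : fderiv 𝕜 φ c e₀ = M.unity) (hτ : τ ∈ V) : fderiv 𝕜 φ τ e₀ = M.unity := by
  obtain ⟨e, he, he'⟩ := h.exists_unity_lift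
  have h1 := h.isOpen.is_const_of_fderiv_eq_zero hV (he.differentiableOn (by simp))
    (fun σ hσ => h.fderiv_unity_lift hn he he' hσ) hτ hc
  have h2 : e c = e₀ := h.injective_fderiv c hc ((he' c hc).trans he₀.symm)
  rw [← h2, ← h1, he' τ hτ]

end IsTangentImmersion

theorem isOrthProj_self {T : Submodule 𝕜 (Fin m → 𝕜)} {v : Fin m → 𝕜} (hv : v ∈ T) :
    IsOrthProj M T v v :=
  ⟨hv, fun w _ => by simp [M.metric_eq_bilinCLM]⟩

/-- In flat coordinates on a ball in which the unity is the first coordinate field, the induced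
structures form a Frobenius manifold. -/
theorem exists_isInducedStructure [NeZero n] {N : Set (Fin m → 𝕜)} {c : Fin n → 𝕜} {ρ : ℝ}
    (hρ : 0 < ρ) (hp : IsLocalParam N (ball c ρ) φ) (h : IsTangentImmersion M (ball c ρ) φ)
    (hn : HasNormalSecondDeriv M (ball c ρ) φ)
    (hunity : fderiv 𝕜 φ c (Pi.single 0 1) = M.unity) :
    ∃ K : FrobeniusManifold 𝕜 n, IsInducedStructure M N K φ ∧ K.region = ball c ρ := by
  have hB : IsOpen (ball c ρ) := isOpen_ball
  have hconn : IsConnected (ball c ρ) :=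
    ⟨⟨c, mem_ball_self hρ⟩, (convex_ball c ρ).isPreconnected⟩
  have hc : c ∈ ball c ρ := mem_ball_self hρ
  obtain ⟨q, r, hq⟩ := h.exists_euler_affine hn hconn.isPreconnected
  obtain ⟨F, hF, hF3⟩ := exists_third_potential hρ h.contDiffOn_pulledThird
    (fun x hx => h.pulledThird_swap₁₂ hx) (fun x hx => h.pulledThird_swap₂₃ hx)
    (fun x hx u v a b => by
      rw [h.fderiv_pulledThird hn hx, h.fderiv_pulledThird hn hx,
        FrobeniusManifold.fderiv_third_swap₁₂ (h.mapsTo hx)])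
  set η := inducedMetric M φ c with hηdef
  have hη : ∀ τ ∈ ball c ρ, inducedMetric M φ τ = η := fun τ hτ =>
    h.inducedMetric_eq hn hconn.isPreconnected hc hτ
  have hmet : ∀ τ ∈ ball c ρ, ∀ a b, metricForm η a b =
      M.metric (fderiv 𝕜 φ τ a) (fderiv 𝕜 φ τ b) := fun τ hτ a b => by
    rw [← hη τ hτ, metricForm_inducedMetric]
  have hdet : IsUnit η.det := h.nondegenerate c hc
  have hI : ∀ τ ∈ ball c ρ, fderiv 𝕜 φ τ (Pi.single 0 1) = M.unity := fun τ hτ =>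
    h.fderiv_eq_unity hn hconn.isPreconnected hc hunity hτ
  -- Both sides are tangent and have the same products with tangent vectors, namely the values of
  -- the pulled back `c`. With injectivity of `Dφ`, this transfers the algebraic axioms from `M`.
  have hmul : ∀ τ ∈ ball c ρ, ∀ a b, fderiv 𝕜 φ τ (prepotentialMul η F τ a b) =
      M.mul (φ τ) (fderiv 𝕜 φ τ a) (fderiv 𝕜 φ τ b) := by
    intro τ hτ a b
    obtain ⟨w, hw⟩ := h.mul_mem τ hτ a b
    rw [← hw, ← sub_eq_zero, ← map_sub]
    have : prepotentialMul η F τ a b - w = 0 := by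
      refine h.eq_zero_of_metric hτ fun d => ?_
      rw [map_sub, M.metric_sub_left, ← hmet τ hτ,
        metricForm_prepotentialMul hdet (inducedMetric_symm c) hB hF hτ, hF3 τ hτ, hw,
        FrobeniusManifold.metric_mul (h.mapsTo hτ), pulledThird_apply, sub_self]
    rw [this, map_zero]
  let K : FrobeniusManifold 𝕜 n :=
    { region := ball c ρ
      isOpen_region := hB
      isConnected_region := hconn
      F := F
      contDiffOn_F := hF
      η := η
      nondegenerate := hdet
      normalization := fun t ht i j => by
        rw [thirdDeriv_eq_third_fderiv hB hF ht, hF3 t ht, pulledThird_apply, hI t ht,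
          FrobeniusManifold.third_unity (h.mapsTo ht), ← hη t ht]
        rfl
      mul_comm' := fun t ht a b => h.injective_fderiv t ht (by
        rw [hmul t ht, hmul t ht, FrobeniusManifold.mul, M.mul_comm' _ (h.mapsTo ht)]
        rfl)
      mul_assoc' := fun t ht a b d => h.injective_fderiv t ht (by
        rw [hmul t ht, hmul t ht, hmul t ht, hmul t ht]
        exact M.mul_assoc' _ (h.mapsTo ht) _ _ _)
      one_mul' := fun t ht a => h.injective_fderiv t ht (by
        rw [hmul t ht, hI t ht]
        exact M.one_mul' _ (h.mapsTo ht) _)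
      q := q
      r := r
      dF := M.dF
      quasihomogeneous := by
        have hL : ContDiffOn 𝕜 ∞ (fun t => fderiv 𝕜 F t (affineField q r t)) (ball c ρ) := by
          refine (hF.fderiv_infty hB).clm_apply ?_
          rw [show affineField q r = fun t => mulVecCLM q t + r from
            funext (affineField_eq q r)]
          exact ((mulVecCLM q).contDiff.add contDiff_const).contDiffOn
        -- Quasihomogeneity of the pulled back tensor says that `L_E F - d_F F` has zero third
        -- derivative, so it is quadratic on the ball.
        obtain ⟨β, B, C, hquad⟩ := exists_quadratic_of_third_fderiv_eq_zero hB
          hconn.isPreconnected ((hF.const_smul (-M.dF)).add hL :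
            ContDiffOn 𝕜 ∞ (fun t => (-M.dF) • F t + fderiv 𝕜 F t (affineField q r t)) _)
          (fun t ht u v w => by
            rw [hF.third_fderiv_smul_add hL hB _ ht]
            simp only [_root_.add_apply, _root_.smul_apply]
            rw [hF.third_fderiv_lie hB ht (hasFDerivAt_affineField q r),
              fderiv_eqOn hB hF3 ht, hF3 t ht, h.fderiv_pulledThird_euler hn hq ht]
            simp)
        refine ⟨fun i j => β (Pi.single i 1) (Pi.single j 1), fun i => B (Pi.single i 1), C,
          fun t ht => ?_⟩
        have h1 := hquad t ht
        have h2 : β t t = ∑ i, ∑ j, β (Pi.single i 1) (Pi.single j 1) * t i * t j := by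
          conv_lhs => rw [clm_apply_eq_sum β t]
          simp only [_root_.sum_apply, _root_.smul_apply]
          refine Finset.sum_congr rfl fun i _ => ?_
          rw [clm_apply_eq_sum (β (Pi.single i 1)) t, Finset.smul_sum]
          refine Finset.sum_congr rfl fun j _ => ?_
          simp only [smul_eq_mul]
          ring
        have h3 : B t = ∑ i, B (Pi.single i 1) * t i := by
          rw [clm_apply_eq_sum B t]
          simp only [smul_eq_mul, mul_comm]
        rw [sum_affineField_mul_coordDeriv, ← h2, ← h3, ← h1, smul_eq_mul]
        ring }
  have htan : ∀ τ ∈ ball c ρ, ∀ u, fderiv 𝕜 φ τ u ∈ submanifoldTangent n N (φ τ) :=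
    fun τ hτ u => (hp.mem_tangent_iff hτ).2 ⟨u, rfl⟩
  refine ⟨K, ⟨hp, fun τ hτ a b => hmet τ hτ a b, fun τ hτ a b => ?_, fun τ hτ => ?_,
    fun τ hτ => ?_⟩, rfl⟩
  · rw [← hmul τ hτ]
    exact isOrthProj_self (htan τ hτ _)
  · rw [← hI τ hτ]
    exact isOrthProj_self (htan τ hτ _)
  · rw [← hq τ hτ]
    exact isOrthProj_self (htan τ hτ _)

end PulledBackStructure

/-! ### Arbitrary induced structures and the main theorem. -/

section InducedStructures

open Set Metric

variable {𝕜 : Type*} [RCLike 𝕜] {m n : ℕ} [NeZero m] {M : FrobeniusManifold 𝕜 m}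
  {N : Set (Fin m → 𝕜)} {V : Set (Fin n → 𝕜)} {φ : (Fin n → 𝕜) → (Fin m → 𝕜)}

theorem IsFlatSubmanifold.isTangentImmersion [NeZero n] (hflat : IsFlatSubmanifold M n N)
    (hunity : ∀ x ∈ N, M.unity ∈ submanifoldTangent n N x)
    (hmul : ∀ x ∈ N, ∀ a ∈ submanifoldTangent n N x, ∀ b ∈ submanifoldTangent n N x,
      M.mul x a b ∈ submanifoldTangent n N x)
    (heuler : ∀ x ∈ N, M.euler x ∈ submanifoldTangent n N x) (h : IsLocalParam N V φ) :
    IsTangentImmersion M V φ where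
  isOpen := h.isOpen
  contDiffOn := h.contDiffOn
  injective_fderiv := h.injective_fderiv
  mapsTo _ hτ := hflat.subset_region (h.mem hτ)
  nondegenerate := hflat.nondegenerate V φ h
  mul_mem _ hτ a b := (h.mem_tangent_iff hτ).1 (hmul _ (h.mem hτ) _
    ((h.mem_tangent_iff hτ).2 ⟨a, rfl⟩) _ ((h.mem_tangent_iff hτ).2 ⟨b, rfl⟩))
  unity_mem _ hτ := (h.mem_tangent_iff hτ).1 (hunity _ (h.mem hτ))
  euler_mem _ hτ := (h.mem_tangent_iff hτ).1 (heuler _ (h.mem hτ))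

/-- A tangent vector is its own orthogonal projection. -/
theorem IsTangentImmersion.eq_of_isOrthProj (h : IsTangentImmersion M V φ)
    (hp : IsLocalParam N V φ) {τ : Fin n → 𝕜} (hτ : τ ∈ V) {v p : Fin m → 𝕜}
    (hv : ∃ u, fderiv 𝕜 φ τ u = v) (ho : IsOrthProj M (submanifoldTangent n N (φ τ)) v p) :
    p = v := by
  obtain ⟨a, ha⟩ := (hp.mem_tangent_iff hτ).1 ho.1
  obtain ⟨b, hb⟩ := hv
  have : b - a = 0 := h.eq_zero_of_metric hτ fun d => by
    rw [map_sub, ha, hb]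
    exact ho.2 _ ((hp.mem_tangent_iff hτ).2 ⟨d, rfl⟩)
  rw [← ha, ← hb, sub_eq_zero.1 this]

/-- The properties of the structures induced on a submanifold to which the unity, the products
and the Euler field are tangent. -/
theorem IsInducedStructure.properties [NeZero n] {K : FrobeniusManifold 𝕜 n}
    (hK : IsInducedStructure M N K φ) (h : IsTangentImmersion M K.region φ) :
    K.dF = M.dF ∧
      (∀ τ ∈ K.region,
        fderiv 𝕜 φ τ K.unity = M.unity ∧
        fderiv 𝕜 φ τ (K.euler τ) = M.euler (φ τ) ∧
        ∀ α β γ, thirdDeriv K.F α β γ τ =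
          ∑ i, ∑ j, ∑ k, fderiv 𝕜 φ τ (Pi.single α 1) i * fderiv 𝕜 φ τ (Pi.single β 1) j *
            fderiv 𝕜 φ τ (Pi.single γ 1) k * thirdDeriv M.F i j k (φ τ)) ∧
      ∀ d₁ : 𝕜, (∀ i, M.q i 0 = d₁ * M.unity i) → ∀ α, K.q α 0 = d₁ * K.unity α := by
  have hp := hK.isLocalParam
  have hn : HasNormalSecondDeriv M K.region φ :=
    hasNormalSecondDeriv_of_const h.isOpen h.contDiffOn (g := K.η) fun τ hτ => by
      ext i j
      refine (hK.metric_eq τ hτ (Pi.single i 1) (Pi.single j 1)).symm.trans ?_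
      simp [FrobeniusManifold.metric, metricForm, Pi.single_apply]
  have hI : ∀ τ ∈ K.region, fderiv 𝕜 φ τ K.unity = M.unity := fun τ hτ =>
    h.eq_of_isOrthProj hp hτ (h.unity_mem τ hτ) (hK.unity_eq τ hτ)
  have hE : ∀ τ ∈ K.region, fderiv 𝕜 φ τ (affineField K.q K.r τ) = M.euler (φ τ) := fun τ hτ =>
    h.eq_of_isOrthProj hp hτ (h.euler_mem τ hτ) (hK.euler_eq τ hτ)
  -- Metric and product determine the structure tensor, since `c(a, b, d) = ⟨a ∘ b, d⟩` on both
  -- manifolds.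
  have hthird : ∀ τ ∈ K.region, K.third τ = pulledThird M φ τ := by
    intro τ hτ
    ext1 a; ext1 b; ext1 d
    have hmul := h.eq_of_isOrthProj hp hτ (h.mul_mem τ hτ a b) (hK.mul_eq τ hτ a b)
    rw [← FrobeniusManifold.metric_mul hτ, hK.metric_eq τ hτ, hmul,
      FrobeniusManifold.metric_mul (h.mapsTo hτ), pulledThird_apply]
  obtain ⟨τ₀, hτ₀⟩ := K.isConnected_region.nonempty
  have hqI : mulVecCLM M.q M.unity = fderiv 𝕜 φ τ₀ (mulVecCLM K.q K.unity) := by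
    have hξ : ContDiffOn 𝕜 ∞ (affineField K.q K.r) K.region := by
      rw [show affineField K.q K.r = fun t => mulVecCLM K.q t + K.r from
        funext (affineField_eq K.q K.r)]
      exact ((mulVecCLM K.q).contDiff.add contDiff_const).contDiffOn
    rw [h.mulVecCLM_unity hn contDiffOn_const hI hξ hE hτ₀,
      (hasFDerivAt_affineField K.q K.r τ₀).fderiv]
  refine ⟨?_, fun τ hτ => ⟨hI τ hτ, hE τ hτ, fun α β γ => ?_⟩, fun d₁ hd₁ α => ?_⟩
  -- The same tensor is quasihomogeneous of both degrees along the same field. With the unity in two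
  -- slots the difference is a multiple of `⟨𝕀, b⟩`, which is nonzero for some `b`.
  · have key : ∀ b, (K.dF - M.dF) * K.metric K.unity b = 0 := by
      intro b
      have h1 := h.fderiv_pulledThird_euler hn hE hτ₀ K.unity K.unity b
      have h2 := FrobeniusManifold.fderiv_third_euler hτ₀ K.unity K.unity b
      rw [FrobeniusManifold.euler, fderiv_eqOn K.isOpen_region hthird hτ₀, hthird τ₀ hτ₀, h1,
        ← hthird τ₀ hτ₀, FrobeniusManifold.third_unity hτ₀] at h2
      linear_combination -h2
    by_contra hne
    refine K.unity_ne_zero (K.eq_zero_of_metric fun b => ?_)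
    exact (mul_eq_zero.1 (key b)).resolve_left (sub_ne_zero.2 hne)
  · rw [FrobeniusManifold.thirdDeriv_eq hτ, hthird τ hτ, pulledThird_apply,
      trilinear_apply_eq_sum]
    simp only [FrobeniusManifold.thirdDeriv_eq (h.mapsTo hτ)]
  -- The hypothesis says `[𝕀, E] = d₁ 𝕀`; by `hqI` this bracket is the image of the one on the
  -- submanifold, and `Dφ` is injective.
  · have h1 : mulVecCLM M.q M.unity = d₁ • M.unity := by
      ext i
      rw [FrobeniusManifold.unity, mulVecCLM_single, hd₁ i]
      rfl
    rw [hqI, ← hI τ₀ hτ₀, ← map_smul] at h1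
    have h2 := congrFun (h.injective_fderiv τ₀ hτ₀ h1) α
    rwa [FrobeniusManifold.unity, mulVecCLM_single] at h2

end InducedStructures

theorem mainTheorem3 {𝕜 : Type*} [RCLike 𝕜] {m n : ℕ} [NeZero m] [NeZero n]
    (M : FrobeniusManifold 𝕜 m) (N : Set (Fin m → 𝕜))
    (hflat : IsFlatSubmanifold M n N)
    (hunity : ∀ x ∈ N, M.unity ∈ submanifoldTangent n N x)
    (hmul : ∀ x ∈ N, ∀ a ∈ submanifoldTangent n N x, ∀ b ∈ submanifoldTangent n N x,
      M.mul x a b ∈ submanifoldTangent n N x)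
    (heuler : ∀ x ∈ N, M.euler x ∈ submanifoldTangent n N x) :
    IsNaturalFrobeniusSubmanifold M n N ∧
    -- every induced Frobenius structure has the stated properties
    (∀ (K : FrobeniusManifold 𝕜 n) (φ : (Fin n → 𝕜) → (Fin m → 𝕜)),
      IsInducedStructure M N K φ →
        K.dF = M.dF ∧
        (∀ τ ∈ K.region,
          fderiv 𝕜 φ τ K.unity = M.unity ∧
          fderiv 𝕜 φ τ (K.euler τ) = M.euler (φ τ) ∧
          ∀ α β γ, thirdDeriv K.F α β γ τ =
            ∑ i, ∑ j, ∑ k, fderiv 𝕜 φ τ (Pi.single α 1) i * fderiv 𝕜 φ τ (Pi.single β 1) j *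
              fderiv 𝕜 φ τ (Pi.single γ 1) k * thirdDeriv M.F i j k (φ τ)) ∧
        ∀ d₁ : 𝕜, (∀ i, M.q i 0 = d₁ * M.unity i) → ∀ α, K.q α 0 = d₁ * K.unity α) ∧
    -- the induced Euler field is linear in every system of flat coordinates
    (∀ (V : Set (Fin n → 𝕜)) (φ : (Fin n → 𝕜) → (Fin m → 𝕜)) (g : Matrix (Fin n) (Fin n) 𝕜),
      IsLocalParam N V φ → IsPreconnected V → (∀ τ ∈ V, inducedMetric M φ τ = g) →
        ∃ (q : Matrix (Fin n) (Fin n) 𝕜) (r : Fin n → 𝕜),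
          ∀ τ ∈ V, fderiv 𝕜 φ τ (affineField q r τ) = M.euler (φ τ)) := by
  have htan : ∀ {V : Set (Fin n → 𝕜)} {φ : (Fin n → 𝕜) → (Fin m → 𝕜)}, IsLocalParam N V φ →
      IsTangentImmersion M V φ := fun h => hflat.isTangentImmersion hunity hmul heuler h
  refine ⟨⟨⟨hflat.isSubmanifold, hflat.subset_region, fun x hx => ?_⟩,
    fun x hx a ha b hb => isOrthProj_self (hmul x hx a ha b hb)⟩,
    fun K φ hK => hK.properties (htan hK.isLocalParam), fun V φ g hp hV hg => ?_⟩
  · obtain ⟨V, φ, hp, c, hc, rfl⟩ := hflat.isSubmanifold x hx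
    obtain ⟨p, ρ, z, hρ, hz, hzV, hzinj, hzinj', hzopen, hzp, hnormal, hu⟩ :=
      (htan hp).exists_flat_reparam (hflat.curvature_eq_zero V φ hp) hc
    have hp' := hp.comp Metric.isOpen_ball hz hzV hzinj hzinj' hzopen
    obtain ⟨K, hK, hKr⟩ := exists_isInducedStructure hρ hp' (htan hp') hnormal hu
    exact ⟨K, φ ∘ z, hK, p, hKr ▸ Metric.mem_ball_self hρ, congrArg φ hzp⟩
  · exact (htan hp).exists_euler_affine
      (hasNormalSecondDeriv_of_const hp.isOpen hp.contDiffOn hg) hV
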